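/- Let $n\ge 3$, let $\Omega\subset\mathbb{R}^n$ be a domain (a non-empty connected open set, not necessarily bounded) with $0\in\Omega$, and let $0<T<\infty$. Let $u$ be a classical solution of the heat equation $u_t=\Delta u$ in $(\Omega\setminus\{0\})\times(0,T)$, that is, $u$, its first and second order spatial derivatives and $u_t$ exist and are continuous in $(\Omega\setminus\{0\})\times(0,T)$ and the equation holds at every point there. One says that $u$ has removable singularities at $\{0\}\times(0,T)$ if there is a classical solution $v$ of the heat equation in $\Omega\times(0,T)$ such that $u=v$ in $(\Omega\setminus\{0\})\times(0,T)$. Then $u$ has removable singularities at $\{0\}\times(0,T)$ if and only if for all $0<t_1<t_2<T$ and every $\delta\in(0,1)$ there is $R_0>0$, depending on $t_1$, $t_2$ and $\delta$, with $\overline{B_{R_0}(0)}\subset\Omega$ and $$|u(x,t)|\le\delta\,|x|^{2-n}\qquad\text{for all } 0<|x|\le R_0 \text{ and } t_1\le t\le t_2 .$$ -/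

import Mathlib

open Set

/-- `u ∈ C^{2,1}(U × I)`: at every point of `U × I` the function `u x t` is twice continuously
differentiable in the space variable `x` and differentiable in the time variable `t`, and `u`,
its first and second spatial derivatives and its time derivative are jointly continuous on
`U × I`. (Used for open `U` and `I`.) -/
structure IsC21On {n : ℕ} (U : Set (EuclideanSpace ℝ (Fin n))) (I : Set ℝ)
    (u : EuclideanSpace ℝ (Fin n) → ℝ → ℝ) : Prop where
  contDiffAt_space : ∀ x ∈ U, ∀ t ∈ I, ContDiffAt ℝ 2 (fun y => u y t) x
  differentiableAt_time : ∀ x ∈ U, ∀ t ∈ I, DifferentiableAt ℝ (fun s => u x s) t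
  continuousOn : ContinuousOn (fun p : EuclideanSpace ℝ (Fin n) × ℝ => u p.1 p.2) (U ×ˢ I)
  continuousOn_fderiv : ContinuousOn
    (fun p : EuclideanSpace ℝ (Fin n) × ℝ => fderiv ℝ (fun y => u y p.2) p.1) (U ×ˢ I)
  continuousOn_fderiv_fderiv : ContinuousOn
    (fun p : EuclideanSpace ℝ (Fin n) × ℝ => fderiv ℝ (fderiv ℝ (fun y => u y p.2)) p.1) (U ×ˢ I)
  continuousOn_deriv_time : ContinuousOn
    (fun p : EuclideanSpace ℝ (Fin n) × ℝ => deriv (fun s => u p.1 s) p.2) (U ×ˢ I)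

/-- `u` is a classical solution of the heat equation `u_t = Δ u` in `U × I`. -/
structure IsClassicalHeatSolution {n : ℕ} (U : Set (EuclideanSpace ℝ (Fin n))) (I : Set ℝ)
    (u : EuclideanSpace ℝ (Fin n) → ℝ → ℝ) : Prop where
  isC21On : IsC21On U I u
  heat_eq : ∀ x ∈ U, ∀ t ∈ I,
    deriv (fun s => u x s) t = Laplacian.laplacian (fun y => u y t) x

/-- `u`, given in `(Ω ∖ {0}) × (0, T)`, has removable singularities at `{0} × (0, T)`: it agrees
there with a classical solution of the heat equation in all of `Ω × (0, T)`. -/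
def HasRemovableSingularities {n : ℕ} (Ω : Set (EuclideanSpace ℝ (Fin n))) (T : ℝ)
    (u : EuclideanSpace ℝ (Fin n) → ℝ → ℝ) : Prop :=
  ∃ v : EuclideanSpace ℝ (Fin n) → ℝ → ℝ, IsClassicalHeatSolution Ω (Ioo 0 T) v ∧
    ∀ x ∈ Ω \ {0}, ∀ t ∈ Ioo 0 T, u x t = v x t

open MeasureTheory Filter Topology
open scoped ContDiff

/-! Necessity is soft: an extension is bounded near a compact piece of the singular line, while
`δ|x|^(2-n)` blows up at the origin because `n ≥ 3`.

Sufficiency has three stages. (1) The line is negligible for the weak equation. Test with `φ(x,t)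
η(x/ε)`, where `η` vanishes near the origin. The extra terms live in `ε ≤ |x| ≤ 2ε` and are
`O(ε⁻²)`; there `|u| ≤ δ ε^(2-n)`, and the region has volume of order `ε^n`. The powers of `ε`
cancel, leaving a bound `δ·const`; let `ε → 0`, then `δ → 0` (`integral_mul_eq_zero_of_removable`).

(2) A weak solution is locally a convolution with a smooth kernel, a form of Weyl's lemma. Let `G`
be the heat kernel and `b` a bump equal to 1 near the space-time origin. Since `(∂ₜ - Δ)G` is the
Dirac mass, `(∂ₜ - Δ)(bG)` is the Dirac mass minus `k = (∂ₜ - Δ)((1 - b)G)`, and `k` is smooth with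
compact support. Testing the weak equation with the reflected `bG` gives `U = U * k` wherever `U` is
continuous (`eq_integral_mul_heatOp_farKernel`). Because `bG` is not an admissible test function, it
is multiplied by a time cutoff `θ_c`; the functions `θ_c' G` then form an approximate identity as `c
→ ∞`.

(3) The right side `U * k` is smooth across the line too. These local extensions agree on the line
by continuity, and there they solve the equation by continuity
(`hasRemovableSingularities_of_local`). -/

/-- The derivative of `f` in the direction `v`. -/
noncomputable def dirDeriv {P : Type*} [NormedAddCommGroup P] [NormedSpace ℝ P] (v : P)
    (f : P → ℝ) (p : P) : ℝ := fderiv ℝ f p v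

/-! ### Calculus of directional derivatives. -/

section DirDeriv

variable {P : Type*} [NormedAddCommGroup P] [NormedSpace ℝ P] {v : P} {f g : P → ℝ} {p : P}

theorem ContDiffAt.dirDeriv (hf : ContDiffAt ℝ ∞ f p) : ContDiffAt ℝ ∞ (dirDeriv v f) p :=
  (hf.fderiv_right (m := ∞) (by simp)).clm_apply contDiffAt_const

theorem ContDiff.dirDeriv (hf : ContDiff ℝ ∞ f) : ContDiff ℝ ∞ (dirDeriv v f) :=
  contDiff_iff_contDiffAt.2 fun _ => hf.contDiffAt.dirDeriv

theorem Filter.EventuallyEq.dirDeriv (h : f =ᶠ[𝓝 p] g) : dirDeriv v f =ᶠ[𝓝 p] dirDeriv v g := by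
  filter_upwards [h.fderiv (𝕜 := ℝ)] with q hq
  simp [_root_.dirDeriv, hq]

theorem ContDiffAt.eventually_differentiableAt (hf : ContDiffAt ℝ ∞ f p) :
    ∀ᶠ q in 𝓝 p, DifferentiableAt ℝ f q := by
  filter_upwards [(hf.of_le (m := 1) (by simp)).eventually (by simp)] with q hq
  exact hq.differentiableAt (by simp)

/-- Stated on a neighbourhood rather than at the point, so that it can be differentiated a second
time. -/
theorem dirDeriv_mul_eventuallyEq (hf : ContDiffAt ℝ ∞ f p) (hg : ContDiffAt ℝ ∞ g p) :
    dirDeriv v (fun q => f q * g q) =ᶠ[𝓝 p]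
      fun q => f q * dirDeriv v g q + g q * dirDeriv v f q := by
  filter_upwards [hf.eventually_differentiableAt, hg.eventually_differentiableAt] with q h1 h2
  simp [dirDeriv, fderiv_fun_mul h1 h2]

theorem dirDeriv_add_eventuallyEq (hf : ContDiffAt ℝ ∞ f p) (hg : ContDiffAt ℝ ∞ g p) :
    dirDeriv v (fun q => f q + g q) =ᶠ[𝓝 p] fun q => dirDeriv v f q + dirDeriv v g q := by
  filter_upwards [hf.eventually_differentiableAt, hg.eventually_differentiableAt] with q h1 h2
  simp [dirDeriv, fderiv_fun_add h1 h2]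

theorem dirDeriv_sub_eventuallyEq (hf : ContDiffAt ℝ ∞ f p) (hg : ContDiffAt ℝ ∞ g p) :
    dirDeriv v (fun q => f q - g q) =ᶠ[𝓝 p] fun q => dirDeriv v f q - dirDeriv v g q := by
  filter_upwards [hf.eventually_differentiableAt, hg.eventually_differentiableAt] with q h1 h2
  simp [dirDeriv, fderiv_fun_sub h1 h2]

theorem dirDeriv_dirDeriv_mul (hf : ContDiffAt ℝ ∞ f p) (hg : ContDiffAt ℝ ∞ g p) :
    dirDeriv v (dirDeriv v (fun q => f q * g q)) p =
      f p * dirDeriv v (dirDeriv v g) p + 2 * (dirDeriv v f p * dirDeriv v g p) +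
        g p * dirDeriv v (dirDeriv v f) p := by
  rw [(dirDeriv_mul_eventuallyEq hf hg).dirDeriv.eq_of_nhds,
    (dirDeriv_add_eventuallyEq (hf.mul hg.dirDeriv) (hg.mul hf.dirDeriv)).eq_of_nhds,
    (dirDeriv_mul_eventuallyEq hf hg.dirDeriv).eq_of_nhds,
    (dirDeriv_mul_eventuallyEq hg hf.dirDeriv).eq_of_nhds]
  ring

theorem dirDeriv_comp_sub_left (f : P → ℝ) (a : P) :
    dirDeriv v (fun q => f (a - q)) = fun q => -dirDeriv v f (a - q) := by
  ext q
  have h1 := (ContinuousLinearEquiv.neg ℝ (M := P)).comp_right_fderiv (f := fun z => f (a + z))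
    (x := q)
  have h2 := fderiv_comp_add_left (𝕜 := ℝ) (f := f) (x := -q) a
  simp only [Function.comp_def, ContinuousLinearEquiv.neg_apply, ← sub_eq_add_neg] at h1 h2
  simp [dirDeriv, h1, h2]

theorem dirDeriv_comp_smul (f : P → ℝ) (c : ℝ) :
    dirDeriv v (fun q => f (c • q)) = fun q => c * dirDeriv v f (c • q) := by
  ext q
  simp [dirDeriv, fderiv_comp_smul]

theorem dirDeriv_const_mul (f : P → ℝ) (c : ℝ) :
    dirDeriv v (fun q => c * f q) = fun q => c * dirDeriv v f q := by
  ext q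
  have := congrFun (fderiv_const_smul_field (𝕜 := ℝ) c (f := f)) q
  simp only [Pi.smul_def, smul_eq_mul] at this
  simp [dirDeriv, this]

theorem dirDeriv_neg (f : P → ℝ) : dirDeriv v (fun q => -f q) = fun q => -dirDeriv v f q := by
  ext q
  simp [dirDeriv]

theorem tsupport_dirDeriv_subset (f : P → ℝ) : tsupport (dirDeriv v f) ⊆ tsupport f :=
  closure_minimal (fun q hq => by
    apply support_fderiv_subset ℝ (f := f)
    intro h
    apply hq
    simp [dirDeriv, h]) (isClosed_tsupport f)

theorem HasCompactSupport.dirDeriv (hf : HasCompactSupport f) :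
    HasCompactSupport (dirDeriv v f) :=
  hf.of_isClosed_subset (isClosed_tsupport _) (tsupport_dirDeriv_subset f)

theorem DifferentiableAt.hasLineDerivAt_dirDeriv (hf : DifferentiableAt ℝ f p) :
    HasLineDerivAt ℝ f (_root_.dirDeriv v f p) p v :=
  hf.hasFDerivAt.hasLineDerivAt v

end DirDeriv

/-! ### The heat operator on space-time. -/

section HeatOp

variable {n : ℕ}

/-- The unit vector of space-time in the `i`-th space direction. -/
noncomputable def spaceDir (i : Fin n) : EuclideanSpace ℝ (Fin n) × ℝ :=
  (EuclideanSpace.single i 1, 0)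

/-- The unit vector of space-time in the time direction. -/
def timeDir (n : ℕ) : EuclideanSpace ℝ (Fin n) × ℝ := (0, 1)

/-- The Laplacian in the space variable of a function on space-time. -/
noncomputable def spaceLaplacian (f : EuclideanSpace ℝ (Fin n) × ℝ → ℝ)
    (p : EuclideanSpace ℝ (Fin n) × ℝ) : ℝ :=
  ∑ i, dirDeriv (spaceDir i) (dirDeriv (spaceDir i) f) p

/-- The heat operator `∂ₜ - Δ` on functions on space-time. -/
noncomputable def heatOp (f : EuclideanSpace ℝ (Fin n) × ℝ → ℝ)
    (p : EuclideanSpace ℝ (Fin n) × ℝ) : ℝ :=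
  dirDeriv (timeDir n) f p - spaceLaplacian f p

variable {f g : EuclideanSpace ℝ (Fin n) × ℝ → ℝ} {p : EuclideanSpace ℝ (Fin n) × ℝ}

theorem ContDiff.spaceLaplacian (hf : ContDiff ℝ ∞ f) : ContDiff ℝ ∞ (spaceLaplacian f) := by
  unfold _root_.spaceLaplacian
  exact ContDiff.sum fun i _ => hf.dirDeriv.dirDeriv

theorem ContDiff.heatOp (hf : ContDiff ℝ ∞ f) : ContDiff ℝ ∞ (heatOp f) := by
  unfold _root_.heatOp
  exact hf.dirDeriv.sub hf.spaceLaplacian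

theorem Filter.EventuallyEq.spaceLaplacian (h : f =ᶠ[𝓝 p] g) :
    spaceLaplacian f p = spaceLaplacian g p := by
  unfold _root_.spaceLaplacian
  exact Finset.sum_congr rfl fun i _ => h.dirDeriv.dirDeriv.eq_of_nhds

theorem Filter.EventuallyEq.heatOp (h : f =ᶠ[𝓝 p] g) : heatOp f p = heatOp g p := by
  unfold _root_.heatOp
  rw [h.spaceLaplacian, h.dirDeriv.eq_of_nhds]

theorem heatOp_zero : heatOp (fun _ => 0 : EuclideanSpace ℝ (Fin n) × ℝ → ℝ) = 0 := by
  have h (v : EuclideanSpace ℝ (Fin n) × ℝ) : dirDeriv v (fun _ => (0 : ℝ)) = fun _ => 0 := by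
    ext; simp [dirDeriv]
  ext p
  simp [heatOp, spaceLaplacian, h]

theorem tsupport_spaceLaplacian_subset (f : EuclideanSpace ℝ (Fin n) × ℝ → ℝ) :
    tsupport (spaceLaplacian f) ⊆ tsupport f := by
  refine closure_minimal (fun q hq => ?_) (isClosed_tsupport f)
  contrapose! hq
  have : f =ᶠ[𝓝 q] fun _ => 0 := notMem_tsupport_iff_eventuallyEq.1 hq
  simp only [Function.mem_support, not_not]
  rw [this.spaceLaplacian]
  simp only [spaceLaplacian]
  have h (v : EuclideanSpace ℝ (Fin n) × ℝ) : dirDeriv v (fun _ => (0 : ℝ)) = fun _ => 0 := by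
    ext; simp [dirDeriv]
  simp [h]

theorem heatOp_sub (hf : ContDiffAt ℝ ∞ f p) (hg : ContDiffAt ℝ ∞ g p) :
    heatOp (fun q => f q - g q) p = heatOp f p - heatOp g p := by
  unfold heatOp spaceLaplacian
  rw [(dirDeriv_sub_eventuallyEq hf hg).eq_of_nhds]
  have (i : Fin n) : dirDeriv (spaceDir i) (dirDeriv (spaceDir i) (fun q => f q - g q)) p =
      dirDeriv (spaceDir i) (dirDeriv (spaceDir i) f) p -
        dirDeriv (spaceDir i) (dirDeriv (spaceDir i) g) p := by
    rw [(dirDeriv_sub_eventuallyEq hf hg).dirDeriv.eq_of_nhds,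
      (dirDeriv_sub_eventuallyEq hf.dirDeriv hg.dirDeriv).eq_of_nhds]
  simp only [this, Finset.sum_sub_distrib]
  ring

theorem spaceLaplacian_mul (hf : ContDiffAt ℝ ∞ f p) (hg : ContDiffAt ℝ ∞ g p) :
    spaceLaplacian (fun q => f q * g q) p = f p * spaceLaplacian g p +
      2 * ∑ i, dirDeriv (spaceDir i) f p * dirDeriv (spaceDir i) g p + g p * spaceLaplacian f p := by
  unfold spaceLaplacian
  simp only [dirDeriv_dirDeriv_mul hf hg, Finset.sum_add_distrib, Finset.mul_sum]

theorem dirDeriv_comp_fst {h : EuclideanSpace ℝ (Fin n) → ℝ} (hh : DifferentiableAt ℝ h p.1)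
    (v : EuclideanSpace ℝ (Fin n) × ℝ) :
    dirDeriv v (fun q => h q.1) p = dirDeriv v.1 h p.1 := by
  have := (hh.hasFDerivAt.comp p hasFDerivAt_fst).fderiv
  simp only [Function.comp_def] at this
  simp [dirDeriv, this]

theorem dirDeriv_comp_snd {h : ℝ → ℝ} (hh : DifferentiableAt ℝ h p.2)
    (v : EuclideanSpace ℝ (Fin n) × ℝ) :
    dirDeriv v (fun q => h q.2) p = v.2 * deriv h p.2 := by
  have := (hh.hasFDerivAt.comp p hasFDerivAt_snd).fderiv
  simp only [Function.comp_def] at this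
  simp [dirDeriv, this]

/-- Space derivatives do not see a factor depending on time alone, so no cross term appears. This is
used with `h = timeCutoff c`. -/
theorem heatOp_time_mul {h : ℝ → ℝ} (hh : ContDiff ℝ ∞ h) (hf : ContDiffAt ℝ ∞ f p) :
    heatOp (fun q => h q.2 * f q) p = deriv h p.2 * f p + h p.2 * heatOp f p := by
  have h0 : ContDiff ℝ ∞ (fun q : EuclideanSpace ℝ (Fin n) × ℝ => h q.2) := hh.comp contDiff_snd
  have h1 (i : Fin n) : dirDeriv (spaceDir i)
      (fun q : EuclideanSpace ℝ (Fin n) × ℝ => h q.2) = fun _ => 0 := by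
    ext q
    rw [dirDeriv_comp_snd (hh.differentiable (by simp)).differentiableAt]
    simp [spaceDir]
  have h2 (v : EuclideanSpace ℝ (Fin n) × ℝ) : dirDeriv v (fun _ => (0 : ℝ)) = fun _ => 0 := by
    ext; simp [dirDeriv]
  unfold heatOp
  rw [spaceLaplacian_mul h0.contDiffAt hf,
    (dirDeriv_mul_eventuallyEq h0.contDiffAt hf).eq_of_nhds,
    dirDeriv_comp_snd (hh.differentiable (by simp)).differentiableAt]
  have h3 : spaceLaplacian (fun q : EuclideanSpace ℝ (Fin n) × ℝ => h q.2) p = 0 := by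
    simp [spaceLaplacian, h1, h2]
  rw [h3]
  simp [h1, timeDir]
  ring

/-- Point reflection flips the sign of first derivatives and keeps second ones, so it exchanges the
heat operator with its adjoint `∂ₜ + Δ` up to sign. -/
theorem heatOp_comp_sub_left (f : EuclideanSpace ℝ (Fin n) × ℝ → ℝ)
    (a p : EuclideanSpace ℝ (Fin n) × ℝ) :
    dirDeriv (timeDir n) (fun q => f (a - q)) p + spaceLaplacian (fun q => f (a - q)) p =
      -heatOp f (a - p) := by
  simp only [heatOp, spaceLaplacian, dirDeriv_comp_sub_left, dirDeriv_neg, neg_neg]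
  ring

end HeatOp

/-! ### The one-variable profile of the heat kernel and its flatness at `τ = 0`. -/

/-- The function `τ ^ (-a) * exp (-1 / (4 τ))`, extended by zero to `τ ≤ 0`. -/
noncomputable def flatGaussian (a τ : ℝ) : ℝ :=
  if 0 < τ then Real.exp (-a * Real.log τ - 1 / (4 * τ)) else 0

theorem flatGaussian_of_nonpos (a : ℝ) {τ : ℝ} (h : τ ≤ 0) : flatGaussian a τ = 0 := by
  simp [flatGaussian, h.not_gt]

theorem flatGaussian_nonneg (a τ : ℝ) : 0 ≤ flatGaussian a τ := by
  unfold flatGaussian; split_ifs <;> positivity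

theorem flatGaussian_eq_mul (a τ : ℝ) : flatGaussian a τ = τ * flatGaussian (a + 1) τ := by
  unfold flatGaussian
  split_ifs with h
  · have : -a * Real.log τ - 1 / (4 * τ) =
        Real.log τ + (-(a + 1) * Real.log τ - 1 / (4 * τ)) := by ring
    rw [this, Real.exp_add, Real.exp_log h]
  · simp

/-- Bound `τ^(-a)` by `τ^(-m)` with an integer `m ≥ a`, then use `e^s ≥ s^m / m!` at `s = 1/(4τ)`.
-/
theorem exists_flatGaussian_le (a : ℝ) : ∃ C, 0 ≤ C ∧ ∀ τ ≤ 1, flatGaussian a τ ≤ C := by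
  obtain ⟨m, hm⟩ := exists_nat_ge a
  refine ⟨4 ^ m * m.factorial, by positivity, fun τ hτ => ?_⟩
  unfold flatGaussian
  split_ifs with h
  · have h1 : Real.exp (-a * Real.log τ - 1 / (4 * τ)) ≤
        Real.exp (-m * Real.log τ - 1 / (4 * τ)) := by
      apply Real.exp_le_exp.2
      have := Real.log_nonpos h.le hτ
      nlinarith
    refine h1.trans ?_
    have h2 := Real.pow_div_factorial_le_exp (1 / (4 * τ)) (by positivity) m
    rw [Real.exp_sub, neg_mul, Real.exp_neg, ← Real.log_pow, Real.exp_log (by positivity),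
      div_le_iff₀ (Real.exp_pos _)]
    refine le_trans ?_ (mul_le_mul_of_nonneg_left h2 (by positivity))
    apply le_of_eq
    rw [one_div, inv_pow, mul_pow]
    field_simp
  · positivity

theorem tendsto_flatGaussian_zero (a : ℝ) : Tendsto (flatGaussian a) (𝓝 0) (𝓝 0) := by
  obtain ⟨C, hC, h⟩ := exists_flatGaussian_le (a + 1)
  have h1 : Tendsto (fun τ : ℝ => C * |τ|) (𝓝 0) (𝓝 0) := by
    have : Continuous fun τ : ℝ => C * |τ| := by fun_prop
    simpa using this.tendsto 0
  refine squeeze_zero_norm' ?_ h1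
  filter_upwards [Iic_mem_nhds (zero_lt_one' ℝ)] with τ hτ
  rw [flatGaussian_eq_mul, norm_mul, Real.norm_eq_abs, Real.norm_eq_abs,
    abs_of_nonneg (flatGaussian_nonneg _ _), mul_comm]
  exact mul_le_mul_of_nonneg_right (h τ hτ) (abs_nonneg _)

/-- The family is closed under differentiation, which makes smoothness an induction. At `τ = 0` the
difference quotient is `flatGaussian (a + 1)`, which tends to 0. -/
theorem hasDerivAt_flatGaussian (a τ : ℝ) :
    HasDerivAt (flatGaussian a)
      (-a * flatGaussian (a + 1) τ + 1 / 4 * flatGaussian (a + 2) τ) τ := by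
  rcases lt_trichotomy τ 0 with h | rfl | h
  · have : flatGaussian a =ᶠ[𝓝 τ] fun _ => 0 := by
      filter_upwards [Iio_mem_nhds h] with s hs using flatGaussian_of_nonpos a (le_of_lt hs)
    rw [flatGaussian_of_nonpos _ h.le, flatGaussian_of_nonpos _ h.le]
    simpa using (hasDerivAt_const τ (0 : ℝ)).congr_of_eventuallyEq this
  · rw [flatGaussian_of_nonpos _ le_rfl, flatGaussian_of_nonpos _ le_rfl,
      hasDerivAt_iff_tendsto_slope]
    refine ((tendsto_flatGaussian_zero (a + 1)).mono_left nhdsWithin_le_nhds).congr' ?_ |>.trans ?_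
    · filter_upwards [self_mem_nhdsWithin] with s hs
      rw [slope_def_field, flatGaussian_of_nonpos a le_rfl, flatGaussian_eq_mul a s]
      have : s ≠ 0 := hs
      field_simp
      simp
    · simp
  · have : flatGaussian a =ᶠ[𝓝 τ] fun s => Real.exp (-a * Real.log s - 1 / (4 * s)) := by
      filter_upwards [Ioi_mem_nhds h] with s hs
      simp [flatGaussian, mem_Ioi.1 hs]
    refine HasDerivAt.congr_of_eventuallyEq ?_ this
    have h1 : HasDerivAt (fun s : ℝ => -a * Real.log s - 1 / (4 * s))
        (-a * τ⁻¹ - (-(4 * 1)) / (4 * τ) ^ 2) τ := by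
      have := ((hasDerivAt_id τ).const_mul 4).inv (by simpa using h.ne')
      simp only [id] at this
      refine (((Real.hasDerivAt_log h.ne').const_mul (-a)).sub this).congr_of_eventuallyEq ?_
      filter_upwards with s
      simp [one_div]
    refine h1.exp.congr_deriv ?_
    have e1 := flatGaussian_eq_mul a τ
    have e2 := flatGaussian_eq_mul (a + 1) τ
    have e3 : flatGaussian a τ = Real.exp (-a * Real.log τ - 1 / (4 * τ)) := by
      simp [flatGaussian, h]
    rw [← e3, e1, e2, show a + 1 + 1 = a + 2 by ring]
    field_simp
    ring

theorem contDiff_flatGaussian (a : ℝ) : ContDiff ℝ ∞ (flatGaussian a) := by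
  rw [contDiff_infty]
  intro k
  induction k generalizing a with
  | zero =>
    exact contDiff_zero.2 (continuous_iff_continuousAt.2 fun τ =>
      (hasDerivAt_flatGaussian a τ).continuousAt)
  | succ k ih =>
    rw [Nat.cast_succ, contDiff_succ_iff_deriv]
    refine ⟨fun τ => (hasDerivAt_flatGaussian a τ).differentiableAt, by simp, ?_⟩
    have : deriv (flatGaussian a) =
        fun τ => -a * flatGaussian (a + 1) τ + 1 / 4 * flatGaussian (a + 2) τ :=
      funext fun τ => (hasDerivAt_flatGaussian a τ).deriv
    rw [this]
    exact (contDiff_const.mul (ih _)).add (contDiff_const.mul (ih _))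

/-! ### The heat kernel: smoothness off the origin, the equation, its mass. -/

section HeatKernel

variable {n : ℕ}

/-- The heat kernel on space-time, extended by zero to nonpositive times. -/
noncomputable def heatKernel (p : EuclideanSpace ℝ (Fin n) × ℝ) : ℝ :=
  if 0 < p.2 then
    Real.exp (-(n / 2 : ℝ) * Real.log (4 * Real.pi * p.2) - ‖p.1‖ ^ 2 / (4 * p.2)) else 0

variable {p : EuclideanSpace ℝ (Fin n) × ℝ}

theorem heatKernel_nonneg (p : EuclideanSpace ℝ (Fin n) × ℝ) : 0 ≤ heatKernel p := by
  unfold heatKernel; split_ifs <;> positivity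

theorem heatKernel_of_nonpos (h : p.2 ≤ 0) : heatKernel p = 0 := by
  simp [heatKernel, h.not_gt]

theorem heatKernel_of_pos (h : 0 < p.2) : heatKernel p =
    Real.exp (-(n / 2 : ℝ) * Real.log (4 * Real.pi * p.2) - ‖p.1‖ ^ 2 / (4 * p.2)) := by
  simp [heatKernel, h]

/-- Parabolic scaling: away from `x = 0` the kernel is a smooth function of `x` times a profile in
`t/|x|²`. It gives both smoothness across `t = 0` and decay there. -/
theorem heatKernel_eq_flatGaussian (h : p.1 ≠ 0) : heatKernel p =
    Real.exp (-(n / 2 : ℝ) * Real.log (4 * Real.pi * ‖p.1‖ ^ 2)) *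
      flatGaussian (n / 2) (p.2 / ‖p.1‖ ^ 2) := by
  have hx : 0 < ‖p.1‖ ^ 2 := by positivity
  rcases le_or_gt p.2 0 with ht | ht
  · rw [heatKernel_of_nonpos ht, flatGaussian_of_nonpos _ (div_nonpos_of_nonpos_of_nonneg ht hx.le),
      mul_zero]
  · rw [heatKernel_of_pos ht, flatGaussian, if_pos (by positivity), ← Real.exp_add,
      Real.log_div ht.ne' hx.ne', Real.log_mul (by positivity) hx.ne',
      Real.log_mul (by positivity) ht.ne']
    congr 1
    field_simp
    ring

theorem contDiffAt_heatKernel_of_pos (h : 0 < p.2) : ContDiffAt ℝ ∞ heatKernel p := by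
  have : heatKernel =ᶠ[𝓝 p] fun q : EuclideanSpace ℝ (Fin n) × ℝ =>
      Real.exp (-(n / 2 : ℝ) * Real.log (4 * Real.pi * q.2) - ‖q.1‖ ^ 2 / (4 * q.2)) := by
    filter_upwards [continuousAt_snd.eventually (Ioi_mem_nhds h)] with q hq
    exact heatKernel_of_pos hq
  refine ContDiffAt.congr_of_eventuallyEq ?_ this
  have h4 : 4 * p.2 ≠ 0 := by positivity
  have hpi : 4 * Real.pi * p.2 ≠ 0 := by positivity
  exact ((contDiffAt_const.mul ((contDiffAt_const.mul contDiffAt_snd).log hpi)).sub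
    ((contDiffAt_fst.norm_sq ℝ).div (contDiffAt_const.mul contDiffAt_snd) h4)).exp

theorem contDiffAt_heatKernel (h : p ≠ 0) : ContDiffAt ℝ ∞ heatKernel p := by
  by_cases hx : p.1 = 0
  · have ht : p.2 ≠ 0 := fun ht => h (Prod.ext hx ht)
    rcases ht.lt_or_gt with ht | ht
    · have : heatKernel =ᶠ[𝓝 p] fun _ => 0 := by
        filter_upwards [continuousAt_snd.eventually (Iio_mem_nhds ht)] with q hq
        exact heatKernel_of_nonpos (le_of_lt hq)
      exact contDiffAt_const.congr_of_eventuallyEq this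
    · exact contDiffAt_heatKernel_of_pos ht
  · have : heatKernel =ᶠ[𝓝 p] fun q : EuclideanSpace ℝ (Fin n) × ℝ =>
        Real.exp (-(n / 2 : ℝ) * Real.log (4 * Real.pi * ‖q.1‖ ^ 2)) *
          flatGaussian (n / 2) (q.2 / ‖q.1‖ ^ 2) := by
      filter_upwards [continuousAt_fst.eventually (isOpen_ne.mem_nhds hx)] with q hq
      exact heatKernel_eq_flatGaussian hq
    refine ContDiffAt.congr_of_eventuallyEq ?_ this
    have hx2 : ‖p.1‖ ^ 2 ≠ 0 := by positivity
    have hn : ContDiffAt ℝ ∞ (fun q : EuclideanSpace ℝ (Fin n) × ℝ => ‖q.1‖ ^ 2) p :=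
      contDiffAt_fst.norm_sq ℝ
    exact (contDiffAt_const.mul ((contDiffAt_const.mul hn).log (by positivity))).exp.mul
      ((contDiff_flatGaussian _).contDiffAt.comp p (contDiffAt_snd.div hn hx2))

/-- Reduces derivatives of the heat kernel to one-variable calculus along a line. -/
theorem dirDeriv_eq_of_hasDerivAt {P : Type*} [NormedAddCommGroup P] [NormedSpace ℝ P] {v p : P}
    {f : P → ℝ} {c : ℝ} (hf : DifferentiableAt ℝ f p)
    (h : HasDerivAt (fun s : ℝ => f (p + s • v)) c 0) : dirDeriv v f p = c := by
  have h1 : HasDerivAt (fun s : ℝ => f (p + s • v)) (dirDeriv v f p) 0 :=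
    hf.hasLineDerivAt_dirDeriv
  exact h1.unique h

theorem norm_add_smul_single_sq (x : EuclideanSpace ℝ (Fin n)) (s : ℝ) (i : Fin n) :
    ‖x + s • EuclideanSpace.single i (1 : ℝ)‖ ^ 2 = ‖x‖ ^ 2 + 2 * s * x i + s ^ 2 := by
  rw [norm_add_sq_real, norm_smul, inner_smul_right, EuclideanSpace.inner_single_right]
  simp
  ring

theorem hasDerivAt_heatKernel_space (h : 0 < p.2) (i : Fin n) :
    HasDerivAt (fun s : ℝ => heatKernel (p + s • spaceDir i))
      (-(p.1 i) / (2 * p.2) * heatKernel p) 0 := by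
  have e : (fun s : ℝ => heatKernel (p + s • spaceDir i)) = fun s =>
      Real.exp (-(n / 2 : ℝ) * Real.log (4 * Real.pi * p.2) -
        (‖p.1‖ ^ 2 + 2 * s * p.1 i + s ^ 2) / (4 * p.2)) := by
    ext s
    rw [heatKernel_of_pos (by simpa [spaceDir] using h)]
    simp [spaceDir, norm_add_smul_single_sq]
  rw [e, heatKernel_of_pos h]
  have h1 : HasDerivAt (fun s : ℝ => -(n / 2 : ℝ) * Real.log (4 * Real.pi * p.2) -
        (‖p.1‖ ^ 2 + 2 * s * p.1 i + s ^ 2) / (4 * p.2)) (-(p.1 i) / (2 * p.2)) 0 := by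
    have h2 : HasDerivAt (fun s : ℝ => ‖p.1‖ ^ 2 + 2 * s * p.1 i + s ^ 2) (2 * p.1 i) 0 := by
      have := ((((hasDerivAt_id (0 : ℝ)).const_mul 2).mul_const (p.1 i)).const_add
        (‖p.1‖ ^ 2)).add ((hasDerivAt_id (0 : ℝ)).pow 2)
      refine this.congr_deriv ?_
      simp
    refine ((h2.div_const (4 * p.2)).const_sub _).congr_deriv ?_
    field_simp
    ring
  refine h1.exp.congr_deriv ?_
  simp [mul_comm]

theorem dirDeriv_spaceDir_heatKernel (h : 0 < p.2) (i : Fin n) :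
    dirDeriv (spaceDir i) heatKernel p = -(p.1 i) / (2 * p.2) * heatKernel p :=
  dirDeriv_eq_of_hasDerivAt ((contDiffAt_heatKernel_of_pos h).differentiableAt (by simp))
    (hasDerivAt_heatKernel_space h i)

theorem dirDeriv_dirDeriv_spaceDir_heatKernel (h : 0 < p.2) (i : Fin n) :
    dirDeriv (spaceDir i) (dirDeriv (spaceDir i) heatKernel) p =
      (p.1 i ^ 2 / (4 * p.2 ^ 2) - 1 / (2 * p.2)) * heatKernel p := by
  refine dirDeriv_eq_of_hasDerivAt
    ((contDiffAt_heatKernel_of_pos h).dirDeriv.differentiableAt (by simp)) ?_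
  have e : (fun s : ℝ => dirDeriv (spaceDir i) heatKernel (p + s • spaceDir i)) = fun s =>
      -(p.1 i + s) / (2 * p.2) * heatKernel (p + s • spaceDir i) := by
    ext s
    rw [dirDeriv_spaceDir_heatKernel (by simpa [spaceDir] using h)]
    simp [spaceDir]
  rw [e]
  have h1 : HasDerivAt (fun s : ℝ => -(p.1 i + s) / (2 * p.2)) (-1 / (2 * p.2)) 0 :=
    (((hasDerivAt_id (0 : ℝ)).const_add (p.1 i)).fun_neg).div_const _
  refine (h1.mul (hasDerivAt_heatKernel_space h i)).congr_deriv ?_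
  simp
  field_simp
  ring

theorem dirDeriv_timeDir_heatKernel (h : 0 < p.2) :
    dirDeriv (timeDir n) heatKernel p =
      (‖p.1‖ ^ 2 / (4 * p.2 ^ 2) - n / (2 * p.2)) * heatKernel p := by
  refine dirDeriv_eq_of_hasDerivAt ((contDiffAt_heatKernel_of_pos h).differentiableAt (by simp)) ?_
  have e : (fun s : ℝ => heatKernel (p + s • timeDir n)) =ᶠ[𝓝 0] fun s =>
      Real.exp (-(n / 2 : ℝ) * Real.log (4 * Real.pi * (p.2 + s)) -
        ‖p.1‖ ^ 2 / (4 * (p.2 + s))) := by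
    filter_upwards [Ioi_mem_nhds (show -p.2 < 0 by linarith)] with s hs
    have : 0 < p.2 + s := by linarith [mem_Ioi.1 hs]
    rw [heatKernel_of_pos (by simpa [timeDir] using this)]
    simp [timeDir]
  refine HasDerivAt.congr_of_eventuallyEq ?_ e
  rw [heatKernel_of_pos h]
  have h0 : HasDerivAt (fun s : ℝ => p.2 + s) 1 0 := (hasDerivAt_id (0 : ℝ)).const_add _
  have h1 : HasDerivAt (fun s : ℝ => -(n / 2 : ℝ) * Real.log (4 * Real.pi * (p.2 + s)) -
        ‖p.1‖ ^ 2 / (4 * (p.2 + s))) (‖p.1‖ ^ 2 / (4 * p.2 ^ 2) - n / (2 * p.2)) 0 := by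
    have h2 := ((h0.const_mul (4 * Real.pi)).log
      (by simpa using h.ne')).const_mul (-(n / 2 : ℝ))
    have h3 := (hasDerivAt_const (0 : ℝ) (‖p.1‖ ^ 2)).div (h0.const_mul 4) (by simpa using h.ne')
    refine (h2.sub h3).congr_deriv ?_
    have := Real.pi_ne_zero
    simp only [add_zero]
    field_simp
    ring
  refine h1.exp.congr_deriv ?_
  simp [mul_comm]

theorem heatOp_heatKernel (h : 0 < p.2) : heatOp heatKernel p = 0 := by
  unfold heatOp spaceLaplacian
  simp only [dirDeriv_timeDir_heatKernel h, dirDeriv_dirDeriv_spaceDir_heatKernel h]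
  rw [← Finset.sum_mul, Finset.sum_sub_distrib, ← Finset.sum_div, EuclideanSpace.norm_sq_eq]
  simp
  ring

theorem integral_heatKernel {τ : ℝ} (h : 0 < τ) :
    ∫ z : EuclideanSpace ℝ (Fin n), heatKernel (z, τ) = 1 := by
  have e (z : EuclideanSpace ℝ (Fin n)) : heatKernel (z, τ) =
      Real.exp (-(n / 2 : ℝ) * Real.log (4 * Real.pi * τ)) *
        Real.exp (-(1 / (4 * τ)) * ‖z‖ ^ 2) := by
    rw [heatKernel_of_pos h, ← Real.exp_add]
    congr 1
    field_simp
    ring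
  simp only [e]
  rw [integral_const_mul, GaussianFourier.integral_rexp_neg_mul_sq_norm (by positivity),
    show Real.pi / (1 / (4 * τ)) = 4 * Real.pi * τ by field_simp,
    Real.rpow_def_of_pos (by positivity), ← Real.exp_add, finrank_euclideanSpace,
    Fintype.card_fin, Real.exp_eq_one_iff]
  ring

/-- The Bochner integral of a non-integrable function is 0, whereas this one is 1. -/
theorem integrable_heatKernel {τ : ℝ} (h : 0 < τ) :
    Integrable fun z : EuclideanSpace ℝ (Fin n) => heatKernel (z, τ) :=
  .of_integral_ne_zero (by simp [integral_heatKernel h])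

/-- Split the Gaussian exponent in half: one half gives `exp(-1/(8τ)) ≤ 8τ`, the other is the
Gaussian at time `2τ`. Doubling the time costs the factor `2^(n/2)`. Since the kernel at `2τ` has
mass 1, the mass outside the unit ball is `O(τ)`. -/
theorem heatKernel_le_of_one_le_norm {τ : ℝ} (h : 0 < τ) {z : EuclideanSpace ℝ (Fin n)}
    (hz : 1 ≤ ‖z‖) : heatKernel (z, τ) ≤
      8 * τ * Real.exp ((n / 2 : ℝ) * Real.log 2) * heatKernel (z, 2 * τ) := by
  have h2 : 0 < 2 * τ := by positivity
  have h8 : Real.exp (-(1 / (8 * τ))) ≤ 8 * τ := by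
    rw [Real.exp_neg, inv_le_comm₀ (Real.exp_pos _) (by positivity)]
    have := Real.add_one_le_exp (1 / (8 * τ))
    rw [← one_div]; linarith
  rw [heatKernel_of_pos h, heatKernel_of_pos h2]
  simp only
  rw [show 4 * Real.pi * (2 * τ) = 2 * (4 * Real.pi * τ) by ring,
    Real.log_mul two_ne_zero (by positivity)]
  refine le_trans ?_ (mul_le_mul_of_nonneg_right (mul_le_mul_of_nonneg_right h8
    (Real.exp_pos _).le) (Real.exp_pos _).le)
  rw [← Real.exp_add, ← Real.exp_add]
  apply Real.exp_le_exp.2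
  have : 1 / (8 * τ) ≤ ‖z‖ ^ 2 / (8 * τ) := by gcongr; nlinarith
  have e1 : ‖z‖ ^ 2 / (4 * τ) = 2 * (‖z‖ ^ 2 / (8 * τ)) := by field_simp; ring
  have e2 : ‖z‖ ^ 2 / (4 * (2 * τ)) = ‖z‖ ^ 2 / (8 * τ) := by congr 1; ring
  rw [e1, e2]
  linarith

/-- The heat kernel concentrates at the origin for small times. -/
theorem exists_one_sub_le_setIntegral_heatKernel (n : ℕ) : ∃ C, ∀ τ : ℝ, 0 < τ →
    1 - C * τ ≤ ∫ z in Metric.closedBall (0 : EuclideanSpace ℝ (Fin n)) 1, heatKernel (z, τ) := by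
  refine ⟨8 * Real.exp ((n / 2 : ℝ) * Real.log 2), fun τ h => ?_⟩
  have h1 := integral_add_compl (μ := volume)
    (Metric.isClosed_closedBall (x := (0 : EuclideanSpace ℝ (Fin n))) (ε := 1)).measurableSet
    (integrable_heatKernel h)
  rw [integral_heatKernel h] at h1
  have h2 : ∫ z in (Metric.closedBall (0 : EuclideanSpace ℝ (Fin n)) 1)ᶜ, heatKernel (z, τ) ≤
      ∫ z in (Metric.closedBall (0 : EuclideanSpace ℝ (Fin n)) 1)ᶜ,
        8 * τ * Real.exp ((n / 2 : ℝ) * Real.log 2) * heatKernel (z, 2 * τ) := by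
    refine setIntegral_mono_on (integrable_heatKernel h).integrableOn
      ((integrable_heatKernel (by positivity)).const_mul _).integrableOn
      Metric.isClosed_closedBall.measurableSet.compl fun z hz => ?_
    refine heatKernel_le_of_one_le_norm h ?_
    simp at hz
    exact hz.le
  have h3 : ∫ z in (Metric.closedBall (0 : EuclideanSpace ℝ (Fin n)) 1)ᶜ,
        8 * τ * Real.exp ((n / 2 : ℝ) * Real.log 2) * heatKernel (z, 2 * τ) ≤
      8 * τ * Real.exp ((n / 2 : ℝ) * Real.log 2) := by
    rw [integral_const_mul]
    refine mul_le_of_le_one_right (by positivity) ?_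
    rw [← integral_heatKernel (n := n) (show 0 < 2 * τ by positivity)]
    exact setIntegral_le_integral (integrable_heatKernel (by positivity))
      (.of_forall fun _ => heatKernel_nonneg _)
  linarith

end HeatKernel

/-! ### Time cutoffs. -/

/-- A smooth function of time which vanishes for `t ≤ 1 / c` and equals `1` for `t ≥ 2 / c`. -/
noncomputable def timeCutoff (c t : ℝ) : ℝ := Real.smoothTransition (c * t - 1)

theorem contDiff_timeCutoff (c : ℝ) : ContDiff ℝ ∞ (timeCutoff c) :=
  Real.smoothTransition.contDiff.comp ((contDiff_const.mul contDiff_id).sub contDiff_const)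

theorem timeCutoff_of_le {c t : ℝ} (h : c * t ≤ 1) : timeCutoff c t = 0 :=
  Real.smoothTransition.zero_of_nonpos (by linarith)

theorem timeCutoff_of_ge {c t : ℝ} (h : 2 ≤ c * t) : timeCutoff c t = 1 :=
  Real.smoothTransition.one_of_one_le (by linarith)

theorem abs_timeCutoff_le (c t : ℝ) : |timeCutoff c t| ≤ 1 := by
  rw [timeCutoff, abs_of_nonneg (Real.smoothTransition.nonneg _)]
  exact Real.smoothTransition.le_one _

theorem deriv_timeCutoff (c t : ℝ) :
    deriv (timeCutoff c) t = c * deriv Real.smoothTransition (c * t - 1) := by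
  have h1 : HasDerivAt (fun t : ℝ => c * t - 1) c t := by
    simpa using ((hasDerivAt_id t).const_mul c).sub_const 1
  have h2 : HasDerivAt Real.smoothTransition (deriv Real.smoothTransition (c * t - 1))
      (c * t - 1) :=
    ((Real.smoothTransition.contDiff (n := 1)).differentiable (by simp)).differentiableAt.hasDerivAt
  rw [mul_comm]
  exact (h2.comp t h1).deriv

theorem deriv_timeCutoff_nonneg {c : ℝ} (hc : 0 ≤ c) (t : ℝ) : 0 ≤ deriv (timeCutoff c) t := by
  rw [deriv_timeCutoff]
  exact mul_nonneg hc Real.smoothTransition.monotone.deriv_nonneg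

theorem deriv_timeCutoff_of_lt {c t : ℝ} (h : c * t < 1) : deriv (timeCutoff c) t = 0 := by
  have : timeCutoff c =ᶠ[𝓝 t] fun _ => 0 := by
    have hc : ContinuousAt (fun s : ℝ => c * s) t := by fun_prop
    filter_upwards [hc.eventually (Iio_mem_nhds h)] with s hs
    exact timeCutoff_of_le (le_of_lt hs)
  simp [this.deriv_eq]

theorem deriv_timeCutoff_of_gt {c t : ℝ} (h : 2 < c * t) : deriv (timeCutoff c) t = 0 := by
  have : timeCutoff c =ᶠ[𝓝 t] fun _ => 1 := by
    have hc : ContinuousAt (fun s : ℝ => c * s) t := by fun_prop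
    filter_upwards [hc.eventually (Ioi_mem_nhds h)] with s hs
    exact timeCutoff_of_ge (le_of_lt hs)
  simp [this.deriv_eq]

theorem exists_deriv_timeCutoff_le :
    ∃ M, 0 ≤ M ∧ ∀ c, 0 ≤ c → ∀ t, deriv (timeCutoff c) t ≤ M * c := by
  have h1 : Continuous (deriv Real.smoothTransition) :=
    (Real.smoothTransition.contDiff (n := 1)).continuous_deriv (by simp)
  have h2 : HasCompactSupport (deriv Real.smoothTransition) := by
    refine HasCompactSupport.intro (isCompact_Icc (a := (0 : ℝ)) (b := 1)) fun s hs => ?_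
    have e := deriv_timeCutoff 1 (s + 1)
    simp only [one_mul, add_sub_cancel_right] at e
    rw [← e]
    rw [mem_Icc, not_and_or, not_le, not_le] at hs
    rcases hs with hs | hs
    · exact deriv_timeCutoff_of_lt (by linarith)
    · exact deriv_timeCutoff_of_gt (by linarith)
  obtain ⟨M, hM⟩ := h2.exists_bound_of_continuous h1
  refine ⟨M, (norm_nonneg _).trans (hM 0), fun c hc t => ?_⟩
  rw [deriv_timeCutoff, mul_comm]
  exact mul_le_mul_of_nonneg_right ((le_abs_self _).trans (hM _)) hc

theorem continuous_deriv_timeCutoff (c : ℝ) : Continuous (deriv (timeCutoff c)) :=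
  (contDiff_timeCutoff c).continuous_deriv (by simp)

theorem setIntegral_deriv_timeCutoff {c : ℝ} (hc : 2 ≤ c) :
    ∫ t in Icc (-1 : ℝ) 1, deriv (timeCutoff c) t = 1 := by
  rw [integral_Icc_eq_integral_Ioc, ← intervalIntegral.integral_of_le (by norm_num),
    intervalIntegral.integral_deriv_eq_sub
      (fun t _ => ((contDiff_timeCutoff c).differentiable (by simp)).differentiableAt)
      ((continuous_deriv_timeCutoff c).intervalIntegrable _ _),
    timeCutoff_of_ge (by linarith), timeCutoff_of_le (by linarith), sub_zero]

/-! ### The approximate identity `θ_c' G` in space-time. -/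

section Peak

variable {n : ℕ}

theorem contDiff_timeCutoff_mul_heatKernel (c : ℝ) :
    ContDiff ℝ ∞ fun q : EuclideanSpace ℝ (Fin n) × ℝ => timeCutoff c q.2 * heatKernel q := by
  rw [contDiff_iff_contDiffAt]
  intro p
  by_cases hp : p = 0
  · have : (fun q : EuclideanSpace ℝ (Fin n) × ℝ => timeCutoff c q.2 * heatKernel q) =ᶠ[𝓝 p]
        fun _ => 0 := by
      have hcont : ContinuousAt (fun q : EuclideanSpace ℝ (Fin n) × ℝ => c * q.2) p := by fun_prop
      filter_upwards [hcont.eventually (Iio_mem_nhds (show c * p.2 < 1 by simp [hp]))] with q hq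
      rw [timeCutoff_of_le (le_of_lt hq), zero_mul]
    exact contDiffAt_const.congr_of_eventuallyEq this
  · exact ((contDiff_timeCutoff c).contDiffAt.comp p contDiffAt_snd).mul (contDiffAt_heatKernel hp)

theorem continuous_deriv_timeCutoff_mul_heatKernel (c : ℝ) :
    Continuous fun q : EuclideanSpace ℝ (Fin n) × ℝ =>
      deriv (timeCutoff c) q.2 * heatKernel q := by
  rw [continuous_iff_continuousAt]
  intro p
  by_cases hp : p = 0
  · have : (fun q : EuclideanSpace ℝ (Fin n) × ℝ => deriv (timeCutoff c) q.2 * heatKernel q)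
        =ᶠ[𝓝 p] fun _ => 0 := by
      have hcont : ContinuousAt (fun q : EuclideanSpace ℝ (Fin n) × ℝ => c * q.2) p := by fun_prop
      filter_upwards [hcont.eventually (Iio_mem_nhds (show c * p.2 < 1 by simp [hp]))] with q hq
      rw [deriv_timeCutoff_of_lt hq, zero_mul]
    exact continuousAt_const.congr_of_eventuallyEq this
  · exact ((continuous_deriv_timeCutoff c).comp continuous_snd).continuousAt.mul
      (contDiffAt_heatKernel hp).continuousAt

theorem tendsto_setIntegral_deriv_timeCutoff_mul_heatKernel :
    Tendsto (fun c : ℝ => ∫ q in Metric.closedBall (0 : EuclideanSpace ℝ (Fin n)) 1 ×ˢ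
      Icc (-1 : ℝ) 1, deriv (timeCutoff c) q.2 * heatKernel q) atTop (𝓝 1) := by
  obtain ⟨C, hC⟩ := exists_one_sub_le_setIntegral_heatKernel n
  have hlim : Tendsto (fun c : ℝ => 1 - |C| * (2 / c)) atTop (𝓝 1) := by
    have : Tendsto (fun c : ℝ => (2 : ℝ) / c) atTop (𝓝 0) := tendsto_const_nhds.div_atTop tendsto_id
    simpa using (this.const_mul |C|).const_sub 1
  have key (c : ℝ) (hc : 2 ≤ c) :
      ∫ q in Metric.closedBall (0 : EuclideanSpace ℝ (Fin n)) 1 ×ˢ Icc (-1 : ℝ) 1,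
        deriv (timeCutoff c) q.2 * heatKernel q = ∫ t in Icc (-1 : ℝ) 1, deriv (timeCutoff c) t *
          ∫ z in Metric.closedBall (0 : EuclideanSpace ℝ (Fin n)) 1, heatKernel (z, t) := by
    have hint : IntegrableOn (fun q : EuclideanSpace ℝ (Fin n) × ℝ =>
        deriv (timeCutoff c) q.2 * heatKernel q)
        (Metric.closedBall (0 : EuclideanSpace ℝ (Fin n)) 1 ×ˢ Icc (-1 : ℝ) 1) :=
      (continuous_deriv_timeCutoff_mul_heatKernel c).continuousOn.integrableOn_compact
        ((isCompact_closedBall _ _).prod isCompact_Icc)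
    rw [Measure.volume_eq_prod] at hint ⊢
    rw [IntegrableOn, ← Measure.prod_restrict] at hint
    rw [← Measure.prod_restrict, integral_prod_symm _ hint]
    simp only [integral_const_mul]
  have hnn (c : ℝ) (hc : 2 ≤ c) (t : ℝ) : 0 ≤ deriv (timeCutoff c) t :=
    deriv_timeCutoff_nonneg (by linarith) t
  -- Only `1/c ≤ t ≤ 2/c` contributes, and at such times the mass of the kernel in the unit ball
  -- lies between `1 - |C|·2/c` and 1.
  have hbd (c : ℝ) (hc : 2 ≤ c) (t : ℝ) :
      (1 - |C| * (2 / c)) * deriv (timeCutoff c) t ≤ deriv (timeCutoff c) t *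
          ∫ z in Metric.closedBall (0 : EuclideanSpace ℝ (Fin n)) 1, heatKernel (z, t) ∧
      deriv (timeCutoff c) t *
          ∫ z in Metric.closedBall (0 : EuclideanSpace ℝ (Fin n)) 1, heatKernel (z, t) ≤
        deriv (timeCutoff c) t := by
    rcases lt_or_ge (c * t) 1 with h1 | h1
    · simp [deriv_timeCutoff_of_lt h1]
    rcases lt_or_ge 2 (c * t) with h2 | h2
    · simp [deriv_timeCutoff_of_gt h2]
    have ht : 0 < t := by
      by_contra! h
      nlinarith
    constructor
    · rw [mul_comm]
      refine mul_le_mul_of_nonneg_left (le_trans ?_ (hC t ht)) (hnn c hc t)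
      have h3 : t ≤ 2 / c := by rw [le_div_iff₀ (by linarith)]; linarith
      have h4 : C * t ≤ |C| * (2 / c) := by
        have := le_abs_self C
        have := abs_nonneg C
        nlinarith
      linarith
    · refine mul_le_of_le_one_right (hnn c hc t) ?_
      rw [← integral_heatKernel (n := n) ht]
      exact setIntegral_le_integral (integrable_heatKernel ht)
        (.of_forall fun _ => heatKernel_nonneg _)
  have hmeas (c : ℝ) (hc : 2 ≤ c) : IntegrableOn (fun t => deriv (timeCutoff c) t *
      ∫ z in Metric.closedBall (0 : EuclideanSpace ℝ (Fin n)) 1, heatKernel (z, t))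
      (Icc (-1 : ℝ) 1) := by
    have hint : IntegrableOn (fun q : EuclideanSpace ℝ (Fin n) × ℝ =>
        deriv (timeCutoff c) q.2 * heatKernel q)
        (Metric.closedBall (0 : EuclideanSpace ℝ (Fin n)) 1 ×ˢ Icc (-1 : ℝ) 1) :=
      (continuous_deriv_timeCutoff_mul_heatKernel c).continuousOn.integrableOn_compact
        ((isCompact_closedBall _ _).prod isCompact_Icc)
    rw [Measure.volume_eq_prod, IntegrableOn, ← Measure.prod_restrict] at hint
    have := hint.integral_prod_right
    simpa only [integral_const_mul, IntegrableOn] using this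
  have hd (c : ℝ) : IntegrableOn (deriv (timeCutoff c)) (Icc (-1 : ℝ) 1) :=
    (continuous_deriv_timeCutoff c).continuousOn.integrableOn_compact isCompact_Icc
  refine tendsto_of_tendsto_of_tendsto_of_le_of_le' hlim tendsto_const_nhds ?_ ?_
  · filter_upwards [eventually_ge_atTop 2] with c hc
    rw [key c hc]
    calc 1 - |C| * (2 / c) = ∫ t in Icc (-1 : ℝ) 1,
          (1 - |C| * (2 / c)) * deriv (timeCutoff c) t := by
          rw [integral_const_mul, setIntegral_deriv_timeCutoff hc, mul_one]
      _ ≤ _ := integral_mono ((hd c).const_mul _) (hmeas c hc) fun t => (hbd c hc t).1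
  · filter_upwards [eventually_ge_atTop 2] with c hc
    rw [key c hc]
    exact (integral_mono (hmeas c hc) (hd c) fun t => (hbd c hc t).2).trans_eq
      (setIntegral_deriv_timeCutoff hc)

theorem tendstoUniformlyOn_deriv_timeCutoff_mul_heatKernel
    {u : Set (EuclideanSpace ℝ (Fin n) × ℝ)} (hu : u ∈ 𝓝 0) :
    TendstoUniformlyOn (fun (c : ℝ) (q : EuclideanSpace ℝ (Fin n) × ℝ) =>
      deriv (timeCutoff c) q.2 * heatKernel q) 0 atTop uᶜ := by
  obtain ⟨d, hd, hdu⟩ := Metric.mem_nhds_iff.1 hu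
  obtain ⟨M, hM0, hM⟩ := exists_deriv_timeCutoff_le
  obtain ⟨C, hC0, hC⟩ := exists_flatGaussian_le ((n : ℝ) / 2 + 2)
  set K := Real.exp (-(n / 2 : ℝ) * Real.log (4 * Real.pi * d ^ 2)) with hK
  have hlim : Tendsto (fun c : ℝ => M * K * C * (4 / d ^ 4) / c) atTop (𝓝 0) :=
    tendsto_const_nhds.div_atTop tendsto_id
  rw [Metric.tendstoUniformlyOn_iff]
  intro ε hε
  filter_upwards [hlim.eventually (gt_mem_nhds hε), eventually_gt_atTop (2 / d),
    eventually_gt_atTop (2 / d ^ 2), eventually_gt_atTop 0] with c h1 h2 h3 h0 q hq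
  have hq' : q ∉ Metric.ball (0 : EuclideanSpace ℝ (Fin n) × ℝ) d := fun h => hq (hdu h)
  rw [Pi.zero_apply, dist_zero_left, Real.norm_eq_abs,
    abs_of_nonneg (mul_nonneg (deriv_timeCutoff_nonneg h0.le _) (heatKernel_nonneg _))]
  rcases lt_or_ge (c * q.2) 1 with h4 | h4
  · simpa [deriv_timeCutoff_of_lt h4] using hε
  rcases lt_or_ge 2 (c * q.2) with h5 | h5
  · simpa [deriv_timeCutoff_of_gt h5] using hε
  have ht : 0 < q.2 := by
    by_contra! h
    nlinarith
  have ht2 : q.2 ≤ 2 / c := by rw [le_div_iff₀ h0]; linarith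
  have htd : q.2 < d := by
    refine ht2.trans_lt ?_
    rw [div_lt_iff₀ h0]
    rwa [div_lt_iff₀ hd, mul_comm] at h2
  -- The product carries the sup norm: `q` lies outside the ball of radius `d` and its time
  -- coordinate is below `d`, so its space coordinate is not.
  have hz : d ≤ ‖q.1‖ := by
    rw [mem_ball_zero_iff, Prod.norm_def, max_lt_iff, not_and_or, not_lt, not_lt,
      Real.norm_eq_abs, abs_of_pos ht] at hq'
    rcases hq' with h | h
    · exact h
    · linarith
  have hz0 : q.1 ≠ 0 := fun h => by rw [h, norm_zero] at hz; linarith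
  have hσ0 : 0 ≤ q.2 / ‖q.1‖ ^ 2 := by positivity
  have hσ : q.2 / ‖q.1‖ ^ 2 ≤ 2 / c / d ^ 2 := by gcongr
  have hσ1 : 2 / c / d ^ 2 ≤ 1 := by
    rw [div_div, div_le_one (by positivity)]
    rw [div_lt_iff₀ (by positivity)] at h3
    exact h3.le
  -- Two powers of `σ = t/|x|²` are extracted: one absorbs the factor `c` in the bound for `θ_c'`,
  -- the other leaves decay of order `1/c`.
  have hflat : flatGaussian (n / 2) (q.2 / ‖q.1‖ ^ 2) ≤ (2 / c / d ^ 2) ^ 2 * C := by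
    rw [flatGaussian_eq_mul, flatGaussian_eq_mul, ← mul_assoc, ← sq, add_assoc, one_add_one_eq_two]
    exact mul_le_mul (pow_le_pow_left₀ hσ0 hσ 2) (hC _ (hσ.trans hσ1)) (flatGaussian_nonneg _ _)
      (by positivity)
  have hexp : Real.exp (-(n / 2 : ℝ) * Real.log (4 * Real.pi * ‖q.1‖ ^ 2)) ≤ K := by
    rw [hK]
    apply Real.exp_le_exp.2
    rw [neg_mul, neg_mul, neg_le_neg_iff]
    gcongr
  refine lt_of_le_of_lt ?_ h1
  rw [heatKernel_eq_flatGaussian hz0]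
  calc deriv (timeCutoff c) q.2 * (Real.exp (-(n / 2 : ℝ) * Real.log (4 * Real.pi * ‖q.1‖ ^ 2)) *
        flatGaussian (n / 2) (q.2 / ‖q.1‖ ^ 2)) ≤ (M * c) * (K * ((2 / c / d ^ 2) ^ 2 * C)) := by
        refine mul_le_mul (hM c h0.le _) (mul_le_mul hexp hflat (flatGaussian_nonneg _ _)
          (Real.exp_pos _).le) (mul_nonneg (Real.exp_pos _).le (flatGaussian_nonneg _ _))
          (by positivity)
    _ = _ := by field_simp; ring

/-- The kernels `θ_c' G` form an approximate identity at the origin of space-time. -/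
theorem tendsto_integral_deriv_timeCutoff_mul_heatKernel
    {g : EuclideanSpace ℝ (Fin n) × ℝ → ℝ} (hg : Integrable g) (h0 : ContinuousAt g 0) :
    Tendsto (fun c : ℝ => ∫ q, deriv (timeCutoff c) q.2 * heatKernel q * g q) atTop
      (𝓝 (g 0)) := by
  have ht : Metric.closedBall (0 : EuclideanSpace ℝ (Fin n)) 1 ×ˢ Icc (-1 : ℝ) 1 ∈
      𝓝 (0 : EuclideanSpace ℝ (Fin n) × ℝ) :=
    prod_mem_nhds (Metric.closedBall_mem_nhds _ one_pos) (Icc_mem_nhds (by simp) (by simp))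
  refine tendsto_integral_peak_smul_of_integrable_of_tendsto (μ := volume)
    (φ := fun (c : ℝ) (q : EuclideanSpace ℝ (Fin n) × ℝ) =>
      deriv (timeCutoff c) q.2 * heatKernel q)
    (t := Metric.closedBall (0 : EuclideanSpace ℝ (Fin n)) 1 ×ˢ Icc (-1 : ℝ) 1)
    (Metric.isClosed_closedBall.measurableSet.prod measurableSet_Icc) ht
    ((isCompact_closedBall _ _).prod isCompact_Icc).measure_ne_top ?_ ?_
    tendsto_setIntegral_deriv_timeCutoff_mul_heatKernel ?_ hg h0
  · filter_upwards [eventually_ge_atTop 0] with c hc q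
    exact mul_nonneg (deriv_timeCutoff_nonneg hc _) (heatKernel_nonneg _)
  · intro u hu h
    exact tendstoUniformlyOn_deriv_timeCutoff_mul_heatKernel (hu.mem_nhds h)
  · filter_upwards with c
    exact (continuous_deriv_timeCutoff_mul_heatKernel c).aestronglyMeasurable

end Peak

/-! ### Integration by parts against test functions. -/

section IntegrationByParts

variable {P : Type*} [NormedAddCommGroup P] [MeasurableSpace P] [BorelSpace P]
  {μ : Measure P}

theorem ContinuousOn.integrable_mul_of_tsupport_subset [IsFiniteMeasureOnCompacts μ] {W : Set P}
    {f g : P → ℝ} (hW : IsOpen W) (hf : ContinuousOn f W) (hg : Continuous g)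
    (hgc : HasCompactSupport g) (hgW : tsupport g ⊆ W) : Integrable (fun p => f p * g p) μ := by
  have h1 : tsupport (fun p => f p * g p) ⊆ tsupport g := tsupport_mul_subset_right
  refine Continuous.integrable_of_hasCompactSupport ?_
    (hgc.of_isClosed_subset (isClosed_tsupport _) h1)
  exact continuous_of_tsupport fun p hp =>
    (hf.continuousAt (hW.mem_nhds (hgW (h1 hp)))).mul hg.continuousAt

/-- Only a derivative along `v` is required, and only on `W`: `C^{2,1}` regularity is phrased
through separate space and time derivatives. -/
theorem integral_mul_dirDeriv_eq_neg [NormedSpace ℝ P] [FiniteDimensional ℝ P] [μ.IsAddHaarMeasure] {W : Set P}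
    {f f' g : P → ℝ} {v : P} (hW : IsOpen W) (hf : ContinuousOn f W) (hf' : ContinuousOn f' W)
    (hd : ∀ p ∈ W, HasLineDerivAt ℝ f (f' p) p v) (hg : ContDiff ℝ ∞ g)
    (hgc : HasCompactSupport g) (hgW : tsupport g ⊆ W) :
    ∫ p, f p * dirDeriv v g p ∂μ = -∫ p, f' p * g p ∂μ :=
  integral_bilinear_hasLineDerivAt_right_eq_neg_left_of_integrable
    (B := ContinuousLinearMap.mul ℝ ℝ)
    (hf'.integrable_mul_of_tsupport_subset hW hg.continuous hgc hgW)
    (hf.integrable_mul_of_tsupport_subset hW hg.dirDeriv.continuous hgc.dirDeriv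
      ((tsupport_dirDeriv_subset g).trans hgW))
    (hf.integrable_mul_of_tsupport_subset hW hg.continuous hgc hgW)
    (fun p hp => hd p (hgW hp))
    (fun _ _ => (hg.differentiable (by simp)).differentiableAt.hasLineDerivAt_dirDeriv)

/-- Needs no continuity of `f`, which will be `u` on a compact set meeting the singular line. -/
theorem MeasureTheory.IntegrableOn.integrable_mul_of_eq_zero [T2Space P] {K : Set P} {f g : P → ℝ}
    (hf : IntegrableOn f K μ) (hK : IsCompact K) (hg : Continuous g) (h0 : ∀ p ∉ K, g p = 0) :
    Integrable (fun p => f p * g p) μ := by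
  rw [← integrableOn_iff_integrable_of_support_subset (s := K)]
  · exact hf.mul_continuousOn hg.continuousOn hK
  · intro p hp
    by_contra h
    exact hp (by simp [h0 p h])

end IntegrationByParts

/-! ### Classical solutions are weak solutions. -/

section WeakFormulation

variable {n : ℕ}

instance isAddHaarMeasure_volume_prod_real :
    (volume : Measure (EuclideanSpace ℝ (Fin n) × ℝ)).IsAddHaarMeasure := by
  rw [Measure.volume_eq_prod]
  infer_instance

theorem laplacian_eq_sum_fderiv_fderiv (f : EuclideanSpace ℝ (Fin n) → ℝ)
    (x : EuclideanSpace ℝ (Fin n)) :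
    Laplacian.laplacian f x = ∑ i, fderiv ℝ (fderiv ℝ f) x (EuclideanSpace.single i 1)
      (EuclideanSpace.single i 1) := by
  rw [InnerProductSpace.laplacian_eq_iteratedFDeriv_orthonormalBasis f
    (EuclideanSpace.basisFun (Fin n) ℝ)]
  simp [iteratedFDeriv_two_apply]

/-- A classical solution of the heat equation is a weak solution. -/
theorem IsClassicalHeatSolution.integral_mul_eq_zero {V : Set (EuclideanSpace ℝ (Fin n))}
    {I : Set ℝ} {u : EuclideanSpace ℝ (Fin n) → ℝ → ℝ} (hu : IsClassicalHeatSolution V I u)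
    (hV : IsOpen V) (hI : IsOpen I) {φ : EuclideanSpace ℝ (Fin n) × ℝ → ℝ} (hφ : ContDiff ℝ ∞ φ)
    (hφc : HasCompactSupport φ) (hφV : tsupport φ ⊆ V ×ˢ I) :
    ∫ p, u p.1 p.2 * (dirDeriv (timeDir n) φ p + spaceLaplacian φ p) = 0 := by
  have hW : IsOpen (V ×ˢ I) := hV.prod hI
  have c0 := hu.isC21On.continuousOn
  have ct := hu.isC21On.continuousOn_deriv_time
  have c1 (i : Fin n) : ContinuousOn (fun p : EuclideanSpace ℝ (Fin n) × ℝ =>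
      fderiv ℝ (fun y => u y p.2) p.1 (EuclideanSpace.single i 1)) (V ×ˢ I) :=
    hu.isC21On.continuousOn_fderiv.clm_apply continuousOn_const
  have c2 (i : Fin n) : ContinuousOn (fun p : EuclideanSpace ℝ (Fin n) × ℝ =>
      fderiv ℝ (fderiv ℝ (fun y => u y p.2)) p.1 (EuclideanSpace.single i 1)
        (EuclideanSpace.single i 1)) (V ×ˢ I) :=
    (hu.isC21On.continuousOn_fderiv_fderiv.clm_apply continuousOn_const).clm_apply
      continuousOn_const
  have dt : ∀ p ∈ V ×ˢ I, HasLineDerivAt ℝ (fun p : EuclideanSpace ℝ (Fin n) × ℝ => u p.1 p.2)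
      (deriv (fun s => u p.1 s) p.2) p (timeDir n) := by
    rintro ⟨x, t⟩ ⟨hx, ht⟩
    have h := (hu.isC21On.differentiableAt_time x hx t ht).hasDerivAt
    have h1 : HasLineDerivAt ℝ (fun s => u x s) (deriv (fun s => u x s) t) t 1 := by
      simpa using h.hasFDerivAt.hasLineDerivAt 1
    unfold HasLineDerivAt at h1 ⊢
    simpa [timeDir] using h1
  have d1 (i : Fin n) : ∀ p ∈ V ×ˢ I,
      HasLineDerivAt ℝ (fun p : EuclideanSpace ℝ (Fin n) × ℝ => u p.1 p.2)
      (fderiv ℝ (fun y => u y p.2) p.1 (EuclideanSpace.single i 1)) p (spaceDir i) := by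
    rintro ⟨x, t⟩ ⟨hx, ht⟩
    have h1 := ((hu.isC21On.contDiffAt_space x hx t ht).differentiableAt
      (by simp)).hasFDerivAt.hasLineDerivAt (EuclideanSpace.single i 1)
    unfold HasLineDerivAt at h1 ⊢
    simpa [spaceDir] using h1
  have d2 (i : Fin n) : ∀ p ∈ V ×ˢ I,
      HasLineDerivAt ℝ (fun p : EuclideanSpace ℝ (Fin n) × ℝ =>
        fderiv ℝ (fun y => u y p.2) p.1 (EuclideanSpace.single i 1))
      (fderiv ℝ (fderiv ℝ (fun y => u y p.2)) p.1 (EuclideanSpace.single i 1)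
        (EuclideanSpace.single i 1)) p (spaceDir i) := by
    rintro ⟨x, t⟩ ⟨hx, ht⟩
    have h0 : DifferentiableAt ℝ (fderiv ℝ (fun y => u y t)) x :=
      ((hu.isC21On.contDiffAt_space x hx t ht).fderiv_right (m := 1) (by norm_num)).differentiableAt
        (by simp)
    have h1 := (h0.hasFDerivAt.clm_apply
      (hasFDerivAt_const (EuclideanSpace.single i (1 : ℝ)) x)).hasLineDerivAt
        (EuclideanSpace.single i 1)
    unfold HasLineDerivAt at h1 ⊢
    simpa [spaceDir] using h1
  have et := integral_mul_dirDeriv_eq_neg (μ := volume) hW c0 ct dt hφ hφc hφV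
  -- Two integrations by parts in the same direction, so the signs cancel.
  have ei (i : Fin n) : ∫ p : EuclideanSpace ℝ (Fin n) × ℝ,
      u p.1 p.2 * dirDeriv (spaceDir i) (dirDeriv (spaceDir i) φ) p =
      ∫ p, fderiv ℝ (fderiv ℝ (fun y => u y p.2)) p.1 (EuclideanSpace.single i 1)
        (EuclideanSpace.single i 1) * φ p := by
    have a1 := integral_mul_dirDeriv_eq_neg (μ := volume) hW c0 (c1 i) (d1 i)
      (hφ.dirDeriv (v := spaceDir i)) hφc.dirDeriv ((tsupport_dirDeriv_subset φ).trans hφV)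
    have a2 := integral_mul_dirDeriv_eq_neg (μ := volume) hW (c1 i) (c2 i) (d2 i) hφ hφc hφV
    rw [a1, a2, neg_neg]
  have it := c0.integrable_mul_of_tsupport_subset (μ := volume) hW
    (hφ.dirDeriv (v := timeDir n)).continuous hφc.dirDeriv
    ((tsupport_dirDeriv_subset φ).trans hφV)
  have ii (i : Fin n) := c0.integrable_mul_of_tsupport_subset (μ := volume) hW
    (hφ.dirDeriv (v := spaceDir i)).dirDeriv.continuous (hφc.dirDeriv.dirDeriv (v := spaceDir i))
    ((tsupport_dirDeriv_subset _).trans ((tsupport_dirDeriv_subset φ).trans hφV))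
  have iii (i : Fin n) := (c2 i).integrable_mul_of_tsupport_subset (μ := volume) hW
    hφ.continuous hφc hφV
  simp only [spaceLaplacian, mul_add, Finset.mul_sum]
  rw [integral_add it (integrable_finsetSum _ fun i _ => ii i),
    integral_finsetSum _ fun i _ => ii i, et]
  simp only [ei]
  rw [← integral_finsetSum _ fun i _ => iii i, neg_add_eq_zero]
  refine integral_congr_ae (.of_forall fun p => ?_)
  simp only
  by_cases hp : p ∈ V ×ˢ I
  · rw [hu.heat_eq p.1 hp.1 p.2 hp.2, laplacian_eq_sum_fderiv_fderiv, Finset.sum_mul]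
  · have : φ p = 0 := image_eq_zero_of_notMem_tsupport fun h => hp (hφV h)
    simp [this]

end WeakFormulation

/-! ### Integrability of `u` up to the singular line. -/

section Integrability

variable {n : ℕ}

theorem volume_fst_eq_zero (hn : 1 ≤ n) :
    volume {p : EuclideanSpace ℝ (Fin n) × ℝ | p.1 = 0} = 0 := by
  have : Nonempty (Fin n) := ⟨⟨0, hn⟩⟩
  have h : {p : EuclideanSpace ℝ (Fin n) × ℝ | p.1 = 0} = {0} ×ˢ univ := by ext; simp
  rw [h, Measure.volume_eq_prod, Measure.prod_prod]
  simp

theorem integrableOn_closedBall_inv_norm_pow (hn : 3 ≤ n) (C R : ℝ) :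
    IntegrableOn (fun x : EuclideanSpace ℝ (Fin n) => C * (‖x‖ ^ (n - 2))⁻¹)
      (Metric.closedBall 0 R) := by
  refine (integrableOn_ball_of_norm_le_rpow (α := ((n - 2 : ℕ) : ℝ)) (C := |C|) (r := R + 1)
    (by simp; omega) ?_ (.of_forall fun x => ?_) ?_).mono_set
    (Metric.closedBall_subset_ball (by linarith))
  · simp only [finrank_euclideanSpace, Fintype.card_fin, Nat.cast_lt]
    omega
  · rw [Real.rpow_neg (norm_nonneg _), Real.rpow_natCast, norm_mul]
    simp
  · exact (Measurable.aestronglyMeasurable (by fun_prop))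

/-- The line is a null set, so continuity off it gives measurability. The majorant is locally
integrable since `n - 2 < n`. -/
theorem integrableOn_of_abs_le_inv_norm_pow (hn : 3 ≤ n) {f : EuclideanSpace ℝ (Fin n) × ℝ → ℝ}
    {C R t₁ t₂ : ℝ}
    (hf : ContinuousOn f ((Metric.closedBall 0 R \ {0}) ×ˢ Icc t₁ t₂))
    (hb : ∀ x : EuclideanSpace ℝ (Fin n), 0 < ‖x‖ → ‖x‖ ≤ R → ∀ t ∈ Icc t₁ t₂,
      |f (x, t)| ≤ C * (‖x‖ ^ (n - 2))⁻¹) :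
    IntegrableOn f (Metric.closedBall 0 R ×ˢ Icc t₁ t₂) := by
  have hms : MeasurableSet ((Metric.closedBall (0 : EuclideanSpace ℝ (Fin n)) R \ {0}) ×ˢ
      Icc t₁ t₂) :=
    (Metric.isClosed_closedBall.measurableSet.diff (measurableSet_singleton 0)).prod
      measurableSet_Icc
  have hae : ((Metric.closedBall (0 : EuclideanSpace ℝ (Fin n)) R \ {0}) ×ˢ Icc t₁ t₂ : Set _) =ᵐ[
      volume] (Metric.closedBall (0 : EuclideanSpace ℝ (Fin n)) R ×ˢ Icc t₁ t₂ : Set _) := by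
    have h0 : ∀ᵐ p : EuclideanSpace ℝ (Fin n) × ℝ, p.1 ≠ 0 := by
      rw [ae_iff]
      simpa using volume_fst_eq_zero (by omega : 1 ≤ n)
    filter_upwards [h0] with p hp
    apply propext
    change p ∈ (Metric.closedBall (0 : EuclideanSpace ℝ (Fin n)) R \ {0}) ×ˢ Icc t₁ t₂ ↔
      p ∈ Metric.closedBall (0 : EuclideanSpace ℝ (Fin n)) R ×ˢ Icc t₁ t₂
    simp [hp]
  refine IntegrableOn.congr_set_ae ?_ hae.symm
  -- The factor 1 is the function of time in the product form expected by `mul_prod`.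
  have hdom : IntegrableOn (fun p : EuclideanSpace ℝ (Fin n) × ℝ =>
      C * (‖p.1‖ ^ (n - 2))⁻¹ * 1) (Metric.closedBall 0 R ×ˢ Icc t₁ t₂) := by
    rw [Measure.volume_eq_prod, IntegrableOn, ← Measure.prod_restrict]
    exact (integrableOn_closedBall_inv_norm_pow hn C R).mul_prod (integrable_const 1)
  refine Integrable.mono' (hdom.congr_set_ae hae) (hf.aestronglyMeasurable hms)
    (ae_restrict_of_forall_mem hms fun p hp => ?_)
  rw [mul_one]
  exact hb p.1 (norm_pos_iff.2 hp.1.2) (by simpa using hp.1.1) p.2 hp.2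

end Integrability

/-! ### The spatial cutoff around the singular line. -/

section Puncture

variable {n : ℕ}

/-- A smooth bump function at the origin of space. -/
noncomputable def originBump (n : ℕ) : ContDiffBump (0 : EuclideanSpace ℝ (Fin n)) :=
  ⟨1, 2, one_pos, one_lt_two⟩

/-- A smooth function on space-time, depending on the space variable `x` only, which vanishes for
`‖x‖ ≤ 1` and equals `1` for `‖x‖ ≥ 2`. -/
noncomputable def puncture (q : EuclideanSpace ℝ (Fin n) × ℝ) : ℝ := 1 - originBump n q.1

theorem contDiff_puncture : ContDiff ℝ ∞ (puncture (n := n)) :=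
  contDiff_const.sub ((originBump n).contDiff.comp contDiff_fst)

theorem puncture_of_le {q : EuclideanSpace ℝ (Fin n) × ℝ} (h : ‖q.1‖ ≤ 1) : puncture q = 0 := by
  rw [puncture, (originBump n).one_of_mem_closedBall (by simpa [originBump] using h), sub_self]

theorem puncture_of_ge {q : EuclideanSpace ℝ (Fin n) × ℝ} (h : 2 ≤ ‖q.1‖) : puncture q = 1 := by
  rw [puncture, (originBump n).zero_of_le_dist (by simpa [originBump] using h), sub_zero]

theorem abs_puncture_le (q : EuclideanSpace ℝ (Fin n) × ℝ) : |puncture q| ≤ 1 := by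
  have h1 := (originBump n).nonneg (x := q.1)
  have h2 := (originBump n).le_one (x := q.1)
  rw [puncture, abs_le]
  constructor <;> linarith

theorem dirDeriv_const {P : Type*} [NormedAddCommGroup P] [NormedSpace ℝ P] (v : P) (c : ℝ) :
    dirDeriv v (fun _ => c) = fun _ => 0 := by
  ext
  simp [dirDeriv]

theorem dirDeriv_puncture (v : EuclideanSpace ℝ (Fin n) × ℝ) :
    dirDeriv v puncture = fun q => dirDeriv v.1 (fun x => 1 - originBump n x) q.1 := by
  ext q
  exact dirDeriv_comp_fst (h := fun x => 1 - originBump n x)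
    ((contDiff_const.sub (originBump n).contDiff).differentiable (n := 1) (by simp)).differentiableAt
    v

theorem dirDeriv_timeDir_puncture : dirDeriv (timeDir n) puncture = fun _ => 0 := by
  rw [dirDeriv_puncture]
  ext q
  simp [dirDeriv, timeDir]

theorem dirDeriv_one_sub_originBump (v : EuclideanSpace ℝ (Fin n)) :
    dirDeriv v (fun x => 1 - originBump n x) = fun x => -dirDeriv v (originBump n) x := by
  ext x
  have := fderiv_const_sub (𝕜 := ℝ) (f := originBump n) (x := x) 1
  simp [dirDeriv, this]

theorem dirDeriv_dirDeriv_puncture (i : Fin n) :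
    dirDeriv (spaceDir i) (dirDeriv (spaceDir i) puncture) = fun q =>
      -dirDeriv (EuclideanSpace.single i 1) (dirDeriv (EuclideanSpace.single i 1)
        (originBump n)) q.1 := by
  rw [dirDeriv_puncture]
  ext q
  have hb : ContDiff ℝ ∞ (originBump n) := (originBump n).contDiff
  rw [dirDeriv_one_sub_originBump, dirDeriv_comp_fst
    (h := fun x => -dirDeriv (spaceDir i).1 (originBump n) x)
    (hb.dirDeriv.neg.differentiable (by simp)).differentiableAt, dirDeriv_neg]
  rfl

/-- The cutoff is not compactly supported, but up to sign its derivatives are those of `originBump`,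
which is. -/
theorem exists_puncture_bound (n : ℕ) : ∃ M, 0 ≤ M ∧ ∀ q : EuclideanSpace ℝ (Fin n) × ℝ,
    (∀ i, |dirDeriv (spaceDir i) puncture q| ≤ M) ∧ |spaceLaplacian puncture q| ≤ M := by
  have hb : ContDiff ℝ ∞ (originBump n) := (originBump n).contDiff
  have hc : HasCompactSupport (originBump n) := (originBump n).hasCompactSupport
  have b1 (i : Fin n) := (hc.dirDeriv (v := EuclideanSpace.single i 1)).exists_bound_of_continuous
    hb.dirDeriv.continuous
  have b2 (i : Fin n) := (hc.dirDeriv (v := EuclideanSpace.single i 1)).dirDeriv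
    (v := EuclideanSpace.single i 1) |>.exists_bound_of_continuous hb.dirDeriv.dirDeriv.continuous
  choose M₁ h₁ using b1
  choose M₂ h₂ using b2
  have n1 (i : Fin n) : 0 ≤ M₁ i := (norm_nonneg _).trans (h₁ i 0)
  have n2 (i : Fin n) : 0 ≤ M₂ i := (norm_nonneg _).trans (h₂ i 0)
  have s1 : 0 ≤ ∑ i, M₁ i := Finset.sum_nonneg fun i _ => n1 i
  have s2 : 0 ≤ ∑ i, M₂ i := Finset.sum_nonneg fun i _ => n2 i
  refine ⟨∑ i, M₁ i + ∑ i, M₂ i, by positivity, fun q => ⟨fun i => ?_, ?_⟩⟩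
  · rw [dirDeriv_puncture, dirDeriv_one_sub_originBump, abs_neg]
    have := Finset.single_le_sum (f := M₁) (fun i _ => n1 i) (Finset.mem_univ i)
    exact (h₁ i q.1).trans (by linarith)
  · unfold spaceLaplacian
    simp only [dirDeriv_dirDeriv_puncture]
    refine (Finset.abs_sum_le_sum_abs _ _).trans ?_
    have : ∑ i, |-dirDeriv (EuclideanSpace.single i 1) (dirDeriv (EuclideanSpace.single i 1)
        (originBump n)) q.1| ≤ ∑ i, M₂ i := Finset.sum_le_sum fun i _ => by
      rw [abs_neg]; exact h₂ i q.1
    linarith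

theorem puncture_locally_const {q : EuclideanSpace ℝ (Fin n) × ℝ} (h : ‖q.1‖ < 1 ∨ 2 < ‖q.1‖) :
    ∃ c : ℝ, puncture =ᶠ[𝓝 q] fun _ => c := by
  have hc : ContinuousAt (fun q : EuclideanSpace ℝ (Fin n) × ℝ => ‖q.1‖) q := by fun_prop
  rcases h with h | h
  · refine ⟨0, ?_⟩
    filter_upwards [hc.eventually (gt_mem_nhds h)] with p hp using puncture_of_le hp.le
  · refine ⟨1, ?_⟩
    filter_upwards [hc.eventually (lt_mem_nhds h)] with p hp using puncture_of_ge hp.le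

theorem dirDeriv_puncture_eq_zero {q : EuclideanSpace ℝ (Fin n) × ℝ}
    (h : ‖q.1‖ < 1 ∨ 2 < ‖q.1‖) (v : EuclideanSpace ℝ (Fin n) × ℝ) : dirDeriv v puncture q = 0 := by
  obtain ⟨c, hc⟩ := puncture_locally_const h
  rw [hc.dirDeriv.eq_of_nhds, dirDeriv_const]

theorem spaceLaplacian_puncture_eq_zero {q : EuclideanSpace ℝ (Fin n) × ℝ}
    (h : ‖q.1‖ < 1 ∨ 2 < ‖q.1‖) : spaceLaplacian puncture q = 0 := by
  obtain ⟨c, hc⟩ := puncture_locally_const h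
  rw [hc.spaceLaplacian]
  simp [spaceLaplacian, dirDeriv_const]

end Puncture

/-! ### The weak equation across the singular line. -/

section RemovableWeak

variable {n : ℕ} {Ω : Set (EuclideanSpace ℝ (Fin n))} {T : ℝ}
  {u : EuclideanSpace ℝ (Fin n) → ℝ → ℝ} {φ : EuclideanSpace ℝ (Fin n) × ℝ → ℝ}

/-- The terms produced when the adjoint heat operator is applied to a test function multiplied by
a cutoff around the singular line. -/
noncomputable def cutoffError (φ : EuclideanSpace ℝ (Fin n) × ℝ → ℝ) (ε : ℝ)
    (p : EuclideanSpace ℝ (Fin n) × ℝ) : ℝ :=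
  2 * ∑ i, dirDeriv (spaceDir i) φ p * (ε⁻¹ * dirDeriv (spaceDir i) puncture (ε⁻¹ • p)) +
    φ p * (ε⁻¹ ^ 2 * spaceLaplacian puncture (ε⁻¹ • p))

theorem contDiff_puncture_smul (ε : ℝ) :
    ContDiff ℝ ∞ fun p : EuclideanSpace ℝ (Fin n) × ℝ => puncture (ε⁻¹ • p) :=
  contDiff_puncture.comp (contDiff_const_smul _)

/-- The cutoff is independent of time, so the error comes from the Laplacian alone: a gradient cross
term of order `ε⁻¹` and a term of order `ε⁻²`. -/
theorem adjointHeatOp_mul_puncture (hφ : ContDiff ℝ ∞ φ) (ε : ℝ)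
    (p : EuclideanSpace ℝ (Fin n) × ℝ) :
    dirDeriv (timeDir n) (fun q => φ q * puncture (ε⁻¹ • q)) p +
        spaceLaplacian (fun q => φ q * puncture (ε⁻¹ • q)) p =
      puncture (ε⁻¹ • p) * (dirDeriv (timeDir n) φ p + spaceLaplacian φ p) +
        cutoffError φ ε p := by
  have h := contDiff_puncture_smul (n := n) ε
  have e : spaceLaplacian (fun q : EuclideanSpace ℝ (Fin n) × ℝ => puncture (ε⁻¹ • q)) p =
      ε⁻¹ ^ 2 * spaceLaplacian puncture (ε⁻¹ • p) := by
    simp only [spaceLaplacian, dirDeriv_comp_smul, dirDeriv_const_mul, Finset.mul_sum]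
    refine Finset.sum_congr rfl fun i _ => ?_
    ring
  rw [spaceLaplacian_mul hφ.contDiffAt h.contDiffAt,
    (dirDeriv_mul_eventuallyEq hφ.contDiffAt h.contDiffAt).eq_of_nhds, e, cutoffError]
  simp only [dirDeriv_comp_smul, dirDeriv_timeDir_puncture]
  ring

theorem continuous_cutoffError (hφ : ContDiff ℝ ∞ φ) (ε : ℝ) : Continuous (cutoffError φ ε) := by
  have h1 (i : Fin n) : Continuous (dirDeriv (spaceDir i) φ) := hφ.dirDeriv.continuous
  have h2 (i : Fin n) : Continuous (dirDeriv (spaceDir i) (puncture (n := n))) :=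
    contDiff_puncture.dirDeriv.continuous
  have h3 : Continuous (spaceLaplacian (puncture (n := n))) :=
    contDiff_puncture.spaceLaplacian.continuous
  have h4 := hφ.continuous
  unfold cutoffError
  fun_prop

theorem cutoffError_eq_zero_of_notMem {p : EuclideanSpace ℝ (Fin n) × ℝ} (hp : p ∉ tsupport φ)
    (ε : ℝ) : cutoffError φ ε p = 0 := by
  have h1 (i : Fin n) : dirDeriv (spaceDir i) φ p = 0 :=
    image_eq_zero_of_notMem_tsupport fun h => hp (tsupport_dirDeriv_subset φ h)
  simp [cutoffError, h1, image_eq_zero_of_notMem_tsupport hp]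

theorem cutoffError_eq_zero {p : EuclideanSpace ℝ (Fin n) × ℝ} {ε : ℝ} (hε : 0 < ε)
    (hp : ‖p.1‖ < ε ∨ 2 * ε < ‖p.1‖) : cutoffError φ ε p = 0 := by
  have h : ‖(ε⁻¹ • p).1‖ < 1 ∨ 2 < ‖(ε⁻¹ • p).1‖ := by
    rw [Prod.smul_fst, norm_smul, norm_inv, Real.norm_eq_abs, abs_of_pos hε, inv_mul_eq_div,
      div_lt_one hε, lt_div_iff₀ hε]
    exact hp
  simp [cutoffError, dirDeriv_puncture_eq_zero h, spaceLaplacian_puncture_eq_zero h]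

theorem exists_abs_cutoffError_le (hφ : ContDiff ℝ ∞ φ) (hφc : HasCompactSupport φ) :
    ∃ M, 0 ≤ M ∧ ∀ ε, 0 < ε → ε ≤ 1 → ∀ p, |cutoffError φ ε p| ≤ M * ε⁻¹ ^ 2 := by
  obtain ⟨M, hM0, hM⟩ := exists_puncture_bound n
  obtain ⟨A, hA⟩ := hφc.exists_bound_of_continuous hφ.continuous
  have b1 (i : Fin n) := (hφc.dirDeriv (v := spaceDir i)).exists_bound_of_continuous
    hφ.dirDeriv.continuous
  choose B hB using b1
  have hA0 : 0 ≤ A := (norm_nonneg _).trans (hA 0)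
  have hB0 (i : Fin n) : 0 ≤ B i := (norm_nonneg _).trans (hB i 0)
  have hBs : 0 ≤ ∑ i, B i := Finset.sum_nonneg fun i _ => hB0 i
  refine ⟨2 * ((∑ i, B i) * M) + A * M, by positivity, fun ε hε hε1 p => ?_⟩
  have hi : 1 ≤ ε⁻¹ := (one_le_inv₀ hε).2 hε1
  have hi0 : 0 ≤ ε⁻¹ := by positivity
  have hi2 : ε⁻¹ ≤ ε⁻¹ ^ 2 := by nlinarith
  have t1 : |∑ i, dirDeriv (spaceDir i) φ p * (ε⁻¹ * dirDeriv (spaceDir i) puncture (ε⁻¹ • p))| ≤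
      (∑ i, B i) * M * ε⁻¹ ^ 2 := by
    refine (Finset.abs_sum_le_sum_abs _ _).trans ?_
    rw [Finset.sum_mul, Finset.sum_mul]
    refine Finset.sum_le_sum fun i _ => ?_
    rw [abs_mul, abs_mul, abs_of_nonneg hi0, mul_assoc, mul_comm M]
    exact mul_le_mul (hB i p) (mul_le_mul hi2 ((hM _).1 i) (abs_nonneg _) (by positivity))
      (by positivity) (hB0 i)
  have t2 : |φ p * (ε⁻¹ ^ 2 * spaceLaplacian puncture (ε⁻¹ • p))| ≤ A * M * ε⁻¹ ^ 2 := by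
    rw [abs_mul, abs_mul, abs_of_nonneg (by positivity : 0 ≤ ε⁻¹ ^ 2), mul_assoc, mul_comm M]
    exact mul_le_mul (hA p) (mul_le_mul_of_nonneg_left (hM _).2 (by positivity)) (by positivity) hA0
  refine (abs_add_le _ _).trans ?_
  rw [abs_mul, abs_two]
  linarith

/-- The scaling balance behind the critical exponent: `ε^(2-n) · ε⁻² · ε^n` does not depend on `ε`.
-/
theorem inv_pow_mul_volume_le (hn : 3 ≤ n) {t₁ t₂ : ℝ} (ht : t₁ ≤ t₂) : ∃ C, 0 ≤ C ∧
    ∀ ε, 0 < ε → (ε ^ (n - 2))⁻¹ * ε⁻¹ ^ 2 *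
      volume.real (Metric.closedBall (0 : EuclideanSpace ℝ (Fin n)) (2 * ε) ×ˢ Icc t₁ t₂) = C := by
  refine ⟨2 ^ n * volume.real (Metric.ball (0 : EuclideanSpace ℝ (Fin n)) 1) * (t₂ - t₁),
    mul_nonneg (by positivity) (by linarith), fun ε hε => ?_⟩
  rw [Measure.volume_eq_prod, measureReal_prod_prod, Measure.addHaar_real_closedBall _ _
    (by positivity), Real.volume_real_Icc_of_le ht, finrank_euclideanSpace, Fintype.card_fin]
  obtain ⟨m, rfl⟩ : ∃ m, n = m + 2 := ⟨n - 2, by omega⟩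
  simp only [Nat.add_sub_cancel]
  rw [mul_pow, pow_add ε]
  field_simp

/-- The singular line is negligible for the weak heat equation if `u = o(|x| ^ (2 - n))`. -/
theorem IsClassicalHeatSolution.integral_mul_eq_zero_of_removable (hn : 3 ≤ n) (hΩ : IsOpen Ω)
    (hu : IsClassicalHeatSolution (Ω \ {0}) (Ioo 0 T) u) {t₁ t₂ : ℝ} (ht : t₁ ≤ t₂)
    (hdec : ∀ δ, 0 < δ → ∃ R, 0 < R ∧ ∀ x : EuclideanSpace ℝ (Fin n), 0 < ‖x‖ → ‖x‖ ≤ R →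
      ∀ t ∈ Icc t₁ t₂, |u x t| ≤ δ * (‖x‖ ^ (n - 2))⁻¹)
    (hφ : ContDiff ℝ ∞ φ) (hφc : HasCompactSupport φ) (hφΩ : tsupport φ ⊆ Ω ×ˢ Ioo 0 T)
    (hφt : tsupport φ ⊆ univ ×ˢ Icc t₁ t₂)
    (hint : IntegrableOn (fun p : EuclideanSpace ℝ (Fin n) × ℝ => u p.1 p.2) (tsupport φ)) :
    ∫ p, u p.1 p.2 * (dirDeriv (timeDir n) φ p + spaceLaplacian φ p) = 0 := by
  set L : EuclideanSpace ℝ (Fin n) × ℝ → ℝ :=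
    fun p => dirDeriv (timeDir n) φ p + spaceLaplacian φ p with hL
  have hLc : Continuous L := hφ.dirDeriv.continuous.add hφ.spaceLaplacian.continuous
  have hL0 : ∀ p ∉ tsupport φ, L p = 0 := fun p hp => by
    have h1 : dirDeriv (timeDir n) φ p = 0 :=
      image_eq_zero_of_notMem_tsupport fun h => hp (tsupport_dirDeriv_subset φ h)
    have h2 : spaceLaplacian φ p = 0 :=
      image_eq_zero_of_notMem_tsupport fun h => hp (tsupport_spaceLaplacian_subset φ h)
    simp [hL, h1, h2]
  have hηc (ε : ℝ) := (contDiff_puncture_smul (n := n) ε).continuous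
  have i0 : Integrable fun p : EuclideanSpace ℝ (Fin n) × ℝ => u p.1 p.2 * L p :=
    hint.integrable_mul_of_eq_zero hφc hLc hL0
  have i1 (ε : ℝ) : Integrable fun p : EuclideanSpace ℝ (Fin n) × ℝ =>
      u p.1 p.2 * (puncture (ε⁻¹ • p) * L p) :=
    hint.integrable_mul_of_eq_zero hφc ((hηc ε).mul hLc) fun p hp => by simp [hL0 p hp]
  have i2 (ε : ℝ) : Integrable fun p : EuclideanSpace ℝ (Fin n) × ℝ =>
      u p.1 p.2 * cutoffError φ ε p :=
    hint.integrable_mul_of_eq_zero hφc (continuous_cutoffError hφ ε) fun p hp =>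
      cutoffError_eq_zero_of_notMem hp ε
  -- The punctured test function is supported in `|x| ≥ ε`, where `u` is a classical solution.
  have key (ε : ℝ) (hε : 0 < ε) : ∫ p, u p.1 p.2 * (puncture (ε⁻¹ • p) * L p) =
      -∫ p, u p.1 p.2 * cutoffError φ ε p := by
    have hs : tsupport (fun q : EuclideanSpace ℝ (Fin n) × ℝ => φ q * puncture (ε⁻¹ • q)) ⊆
        tsupport φ := tsupport_mul_subset_left
    have hs2 : tsupport (fun q : EuclideanSpace ℝ (Fin n) × ℝ => φ q * puncture (ε⁻¹ • q)) ⊆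
        {q | ε ≤ ‖q.1‖} := by
      refine closure_minimal (fun q hq => ?_) (isClosed_le continuous_const (by fun_prop))
      by_contra h
      refine hq ?_
      have : puncture (ε⁻¹ • q) = 0 := puncture_of_le (by
        rw [Prod.smul_fst, norm_smul, norm_inv, Real.norm_eq_abs, abs_of_pos hε, inv_mul_eq_div,
          div_le_one hε]
        exact (not_le.1 h).le)
      simp [this]
    have := hu.integral_mul_eq_zero (hΩ.sdiff isClosed_singleton) isOpen_Ioo
      (hφ.mul (contDiff_puncture_smul ε))
      (hφc.of_isClosed_subset (isClosed_tsupport _) hs) (fun p hp => by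
        refine ⟨⟨(hφΩ (hs hp)).1, fun h => ?_⟩, (hφΩ (hs hp)).2⟩
        have h2 : ε ≤ ‖p.1‖ := hs2 hp
        rw [mem_singleton_iff.1 h, norm_zero] at h2
        linarith)
    simp only [adjointHeatOp_mul_puncture hφ] at this
    rw [← add_eq_zero_iff_eq_neg, ← integral_add (i1 ε) (i2 ε), ← this]
    exact integral_congr_ae (.of_forall fun p => (mul_add _ _ _).symm)
  have lim : Tendsto (fun ε : ℝ => ∫ p, u p.1 p.2 * (puncture (ε⁻¹ • p) * L p)) (𝓝[>] 0)
      (𝓝 (∫ p, u p.1 p.2 * L p)) := by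
    refine tendsto_integral_filter_of_dominated_convergence
      (fun p => ‖u p.1 p.2 * L p‖) (.of_forall fun ε => (i1 ε).aestronglyMeasurable)
      (.of_forall fun ε => .of_forall fun p => ?_) i0.norm ?_
    · rw [norm_mul, norm_mul, norm_mul]
      refine mul_le_mul_of_nonneg_left ?_ (norm_nonneg _)
      exact mul_le_of_le_one_left (norm_nonneg _) (abs_puncture_le _)
    · have h0 : ∀ᵐ p : EuclideanSpace ℝ (Fin n) × ℝ, p.1 ≠ 0 := by
        rw [ae_iff]
        simpa using volume_fst_eq_zero (by omega : 1 ≤ n)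
      filter_upwards [h0] with p hp
      refine tendsto_nhds_of_eventually_eq ?_
      have hp' : 0 < ‖p.1‖ / 2 := by positivity
      filter_upwards [Ioo_mem_nhdsGT hp'] with ε hε
      rw [puncture_of_ge, one_mul]
      rw [Prod.smul_fst, norm_smul, norm_inv, Real.norm_eq_abs, abs_of_pos hε.1, inv_mul_eq_div,
        le_div_iff₀ hε.1]
      linarith [hε.2]
  obtain ⟨M, hM0, hM⟩ := exists_abs_cutoffError_le hφ hφc
  obtain ⟨C, hC0, hC⟩ := inv_pow_mul_volume_le hn ht
  have bound (δ : ℝ) (hδ : 0 < δ) : |∫ p, u p.1 p.2 * L p| ≤ δ * (M * C) := by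
    obtain ⟨R, hR, hRu⟩ := hdec δ hδ
    refine le_of_tendsto lim.abs ?_
    have hmin : 0 < min 1 (R / 2) := by positivity
    filter_upwards [Ioo_mem_nhdsGT hmin] with ε hε
    have hε1 : ε ≤ 1 := (hε.2.trans_le (min_le_left _ _)).le
    have hεR : 2 * ε ≤ R := by linarith [hε.2.trans_le (min_le_right 1 (R / 2))]
    rw [key ε hε.1, abs_neg, ← setIntegral_eq_integral_of_forall_compl_eq_zero
      (s := Metric.closedBall (0 : EuclideanSpace ℝ (Fin n)) (2 * ε) ×ˢ Icc t₁ t₂)]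
    · rw [← Real.norm_eq_abs]
      refine (norm_setIntegral_le_of_norm_le_const (C := δ * M * ((ε ^ (n - 2))⁻¹ * ε⁻¹ ^ 2))
        ((isCompact_closedBall _ _).prod isCompact_Icc).measure_lt_top fun p hp => ?_).trans
        (le_of_eq ?_)
      -- The error vanishes for `|x| < ε`; elsewhere `|x|^(2-n) ≤ ε^(2-n)`.
      · rcases lt_or_ge ‖p.1‖ ε with h | h
        · rw [cutoffError_eq_zero hε.1 (.inl h), mul_zero, norm_zero]
          have := hε.1
          positivity
        · have hp0 : 0 < ‖p.1‖ := hε.1.trans_le h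
          have hpR : ‖p.1‖ ≤ 2 * ε := by simpa using hp.1
          rw [norm_mul]
          calc _ ≤ (δ * (ε ^ (n - 2))⁻¹) * (M * ε⁻¹ ^ 2) := by
                refine mul_le_mul ((hRu p.1 hp0 (hpR.trans hεR) p.2 hp.2).trans ?_)
                  (hM ε hε.1 hε1 p) (norm_nonneg _) ?_
                · have := hε.1
                  gcongr
                · have := hε.1
                  positivity
            _ = _ := by ring
      · rw [mul_assoc (δ * M), hC ε hε.1, mul_assoc]
    · intro p hp
      rw [mem_prod, not_and_or] at hp
      rcases hp with hp | hp
      · rw [cutoffError_eq_zero hε.1 (.inr (by simpa using hp)), mul_zero]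
      · rw [cutoffError_eq_zero_of_notMem (fun h => hp (hφt h).2), mul_zero]
  have hMC : 0 ≤ M * C := mul_nonneg hM0 hC0
  by_contra hne
  have hpos : 0 < |∫ p, u p.1 p.2 * L p| := abs_pos.2 hne
  -- This `δ` makes the bound smaller than the integral itself; the added 1 covers the case `M * C =
  -- 0`.
  have := bound (|∫ p, u p.1 p.2 * L p| / (2 * (M * C + 1))) (by positivity)
  have h2 : |∫ p, u p.1 p.2 * L p| / (2 * (M * C + 1)) * (M * C) <
      |∫ p, u p.1 p.2 * L p| := by
    rw [div_mul_eq_mul_div, div_lt_iff₀ (by positivity)]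
    nlinarith
  linarith

end RemovableWeak

/-! ### Splitting the heat kernel into a near and a far part. -/

section Parametrix

variable {n : ℕ}

/-- The heat kernel with its singularity at the origin cut off. -/
noncomputable def farKernel (b : ContDiffBump (0 : EuclideanSpace ℝ (Fin n) × ℝ))
    (p : EuclideanSpace ℝ (Fin n) × ℝ) : ℝ := (1 - b p) * heatKernel p

variable (b : ContDiffBump (0 : EuclideanSpace ℝ (Fin n) × ℝ))

theorem contDiff_farKernel : ContDiff ℝ ∞ (farKernel b) := by
  rw [contDiff_iff_contDiffAt]
  intro p
  by_cases hp : p = 0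
  · subst hp
    have : farKernel b =ᶠ[𝓝 0] fun _ => 0 := by
      filter_upwards [b.eventuallyEq_one] with q hq
      simp [farKernel, hq]
    exact contDiffAt_const.congr_of_eventuallyEq this
  · exact (contDiffAt_const.sub b.contDiff.contDiffAt).mul (contDiffAt_heatKernel hp)

/-- The far kernel vanishes identically for `t < 0`; the slice `t = 0` follows by continuity. -/
theorem heatOp_farKernel_of_nonpos {p : EuclideanSpace ℝ (Fin n) × ℝ} (hp : p.2 ≤ 0) :
    heatOp (farKernel b) p = 0 := by
  have hc : Continuous fun s : ℝ => heatOp (farKernel b) (p.1, s) :=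
    (contDiff_farKernel b).heatOp.continuous.comp (by fun_prop)
  have hclosed : IsClosed {s : ℝ | heatOp (farKernel b) (p.1, s) = 0} :=
    isClosed_eq hc continuous_const
  have hsub : Iio (0 : ℝ) ⊆ {s : ℝ | heatOp (farKernel b) (p.1, s) = 0} := by
    intro s hs
    have : farKernel b =ᶠ[𝓝 (p.1, s)] fun _ => 0 := by
      have hcs : ContinuousAt (Prod.snd : EuclideanSpace ℝ (Fin n) × ℝ → ℝ) (p.1, s) :=
        continuousAt_snd
      filter_upwards [hcs.eventually (Iio_mem_nhds hs)] with q hq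
      simp [farKernel, heatKernel_of_nonpos (le_of_lt hq)]
    change heatOp (farKernel b) (p.1, s) = 0
    rw [this.heatOp, heatOp_zero, Pi.zero_apply]
  have := closure_minimal hsub hclosed
  rw [closure_Iio] at this
  exact this hp

theorem heatOp_farKernel_of_notMem {p : EuclideanSpace ℝ (Fin n) × ℝ}
    (hp : p ∉ Metric.closedBall 0 b.rOut) : heatOp (farKernel b) p = 0 := by
  rcases le_or_gt p.2 0 with h | h
  · exact heatOp_farKernel_of_nonpos b h
  · have : farKernel b =ᶠ[𝓝 p] heatKernel := by
      filter_upwards [Metric.isClosed_closedBall.isOpen_compl.mem_nhds hp] with q hq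
      rw [farKernel, b.zero_of_le_dist (not_le.1 (show ¬dist q 0 ≤ b.rOut from hq)).le, sub_zero, one_mul]
    rw [this.heatOp, heatOp_heatKernel h]

theorem hasCompactSupport_heatOp_farKernel : HasCompactSupport (heatOp (farKernel b)) :=
  HasCompactSupport.intro (isCompact_closedBall 0 b.rOut) fun _ hp =>
    heatOp_farKernel_of_notMem b hp

/-- The heat kernel localized in a neighbourhood of the origin and regularized in time. -/
noncomputable def nearKernel (c : ℝ) (p : EuclideanSpace ℝ (Fin n) × ℝ) : ℝ :=
  timeCutoff c p.2 * heatKernel p - timeCutoff c p.2 * farKernel b p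

/-- The defining difference displays smoothness, since each term is smooth; this product form
displays the compact support. -/
theorem nearKernel_eq (c : ℝ) (p : EuclideanSpace ℝ (Fin n) × ℝ) :
    nearKernel b c p = timeCutoff c p.2 * heatKernel p * b p := by
  rw [nearKernel, farKernel]
  ring

theorem contDiff_timeCutoff_mul_farKernel (c : ℝ) :
    ContDiff ℝ ∞ fun p : EuclideanSpace ℝ (Fin n) × ℝ => timeCutoff c p.2 * farKernel b p :=
  ((contDiff_timeCutoff c).comp contDiff_snd).mul (contDiff_farKernel b)

theorem contDiff_nearKernel (c : ℝ) : ContDiff ℝ ∞ (nearKernel b c) :=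
  (contDiff_timeCutoff_mul_heatKernel c).sub (contDiff_timeCutoff_mul_farKernel b c)

theorem nearKernel_of_notMem (c : ℝ) {p : EuclideanSpace ℝ (Fin n) × ℝ}
    (hp : p ∉ Metric.closedBall 0 b.rOut) : nearKernel b c p = 0 := by
  rw [nearKernel_eq, b.zero_of_le_dist (not_le.1 hp).le, mul_zero]

theorem heatOp_timeCutoff_mul_heatKernel {c : ℝ} (hc : 0 < c)
    (p : EuclideanSpace ℝ (Fin n) × ℝ) :
    heatOp (fun q : EuclideanSpace ℝ (Fin n) × ℝ => timeCutoff c q.2 * heatKernel q) p =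
      deriv (timeCutoff c) p.2 * heatKernel p := by
  rcases le_or_gt p.2 0 with h | h
  · have h1 : c * p.2 < 1 := by nlinarith
    have : (fun q : EuclideanSpace ℝ (Fin n) × ℝ => timeCutoff c q.2 * heatKernel q) =ᶠ[𝓝 p]
        fun _ => 0 := by
      have hcont : ContinuousAt (fun q : EuclideanSpace ℝ (Fin n) × ℝ => c * q.2) p := by fun_prop
      filter_upwards [hcont.eventually (Iio_mem_nhds h1)] with q hq
      rw [timeCutoff_of_le (le_of_lt hq), zero_mul]
    rw [this.heatOp, heatOp_zero, heatKernel_of_nonpos h]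
    simp
  · rw [heatOp_time_mul (contDiff_timeCutoff c) (contDiffAt_heatKernel_of_pos h),
      heatOp_heatKernel h]
    ring

/-- The regularized form of `(∂ₜ - Δ)(bG) = Dirac mass - k`. -/
theorem heatOp_nearKernel {c : ℝ} (hc : 0 < c) (p : EuclideanSpace ℝ (Fin n) × ℝ) :
    heatOp (nearKernel b c) p = deriv (timeCutoff c) p.2 * heatKernel p * b p -
      timeCutoff c p.2 * heatOp (farKernel b) p := by
  unfold nearKernel
  rw [heatOp_sub (contDiff_timeCutoff_mul_heatKernel c).contDiffAt
    (contDiff_timeCutoff_mul_farKernel b c).contDiffAt, heatOp_timeCutoff_mul_heatKernel hc,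
    heatOp_time_mul (contDiff_timeCutoff c) (contDiff_farKernel b).contDiffAt, farKernel]
  ring

end Parametrix

/-! ### Reproduction of weak solutions by a smooth kernel. -/

section Representation

variable {n : ℕ} {U : EuclideanSpace ℝ (Fin n) × ℝ → ℝ}

/-- A weak solution of the heat equation is reproduced by a smooth compactly supported kernel. -/
theorem eq_integral_mul_heatOp_farKernel (b : ContDiffBump (0 : EuclideanSpace ℝ (Fin n) × ℝ))
    (hU : Integrable U) {p : EuclideanSpace ℝ (Fin n) × ℝ} (hp : ContinuousAt U p)
    (hweak : ∀ φ : EuclideanSpace ℝ (Fin n) × ℝ → ℝ, ContDiff ℝ ∞ φ →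
      tsupport φ ⊆ Metric.closedBall p b.rOut →
      ∫ q, U q * (dirDeriv (timeDir n) φ q + spaceLaplacian φ q) = 0) :
    U p = ∫ q, U q * heatOp (farKernel b) (p - q) := by
  set k := heatOp (farKernel b) with hk
  have hkc : Continuous k := (contDiff_farKernel b).heatOp.continuous
  obtain ⟨M, hM⟩ := (hasCompactSupport_heatOp_farKernel b).exists_bound_of_continuous hkc
  have hU' : Integrable fun q => U (p - q) := hU.comp_sub_left p
  have hbU : Integrable fun q => b q * U (p - q) :=
    hU'.bdd_mul (c := 1) b.continuous.aestronglyMeasurable (.of_forall fun q => by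
      rw [Real.norm_eq_abs, abs_of_nonneg b.nonneg]; exact b.le_one)
  have cont0 : ContinuousAt (fun q => b q * U (p - q)) 0 := by
    refine (b.continuous.continuousAt).mul (ContinuousAt.comp (g := U) ?_ (by fun_prop))
    simpa using hp
  have lim1 := tendsto_integral_deriv_timeCutoff_mul_heatKernel hbU cont0
  simp only [sub_zero] at lim1
  rw [b.one_of_mem_closedBall (by simp [b.rIn_pos.le]), one_mul] at lim1
  have lim2 : Tendsto (fun c : ℝ => ∫ q, timeCutoff c q.2 * k q * U (p - q)) atTop
      (𝓝 (∫ q, k q * U (p - q))) := by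
    refine tendsto_integral_filter_of_dominated_convergence (fun q => M * ‖U (p - q)‖)
      (.of_forall fun c => ?_) (.of_forall fun c => .of_forall fun q => ?_)
      (hU'.norm.const_mul M) (.of_forall fun q => ?_)
    · exact (((contDiff_timeCutoff c).continuous.comp continuous_snd).mul
        hkc).aestronglyMeasurable.mul hU'.aestronglyMeasurable
    · rw [norm_mul, norm_mul]
      refine mul_le_mul_of_nonneg_right ?_ (norm_nonneg _)
      exact (mul_le_of_le_one_left (norm_nonneg _) (abs_timeCutoff_le _ _)).trans (hM q)
    · refine tendsto_nhds_of_eventually_eq ?_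
      -- For `t ≤ 0` the kernel `k` is zero; for `t > 0` the cutoff equals 1 once `c ≥ 2/t`.
      rcases le_or_gt q.2 0 with h | h
      · filter_upwards with c
        rw [hk, heatOp_farKernel_of_nonpos b h]
        ring
      · filter_upwards [eventually_ge_atTop (2 / q.2)] with c hc
        rw [timeCutoff_of_ge ((div_le_iff₀ h).1 hc), one_mul]
  -- The weak equation is tested with the near kernel reflected about `p`; reflection turns the
  -- adjoint operator back into `heatOp`.
  have heq : ∀ᶠ c : ℝ in atTop, ∫ q, deriv (timeCutoff c) q.2 * heatKernel q * (b q * U (p - q)) =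
      ∫ q, timeCutoff c q.2 * k q * U (p - q) := by
    filter_upwards [eventually_gt_atTop 0] with c hc
    have hsupp : tsupport (fun q => nearKernel b c (p - q)) ⊆ Metric.closedBall p b.rOut := by
      refine closure_minimal (fun q hq => ?_) Metric.isClosed_closedBall
      by_contra h
      refine hq (nearKernel_of_notMem b c fun h' => h ?_)
      rw [mem_closedBall_zero_iff, norm_sub_rev] at h'
      rwa [Metric.mem_closedBall, dist_eq_norm]
    have h := hweak (fun q => nearKernel b c (p - q))
      ((contDiff_nearKernel b c).comp (contDiff_const.sub contDiff_id)) hsupp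
    simp only [heatOp_comp_sub_left] at h
    have h2 : ∫ q, U (p - q) * heatOp (nearKernel b c) q = 0 := by
      rw [← integral_sub_left_eq_self _ volume p]
      simp only [sub_sub_cancel]
      simpa [integral_neg] using h
    obtain ⟨M₁, hM₁⟩ := (b.hasCompactSupport.mul_left (f := fun q : EuclideanSpace ℝ (Fin n) × ℝ =>
      deriv (timeCutoff c) q.2 * heatKernel q)).exists_bound_of_continuous
      ((continuous_deriv_timeCutoff_mul_heatKernel c).mul b.continuous)
    have i1 : Integrable fun q : EuclideanSpace ℝ (Fin n) × ℝ =>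
        deriv (timeCutoff c) q.2 * heatKernel q * (b q * U (p - q)) := by
      simp only [← mul_assoc]
      exact hU'.bdd_mul (c := M₁) ((continuous_deriv_timeCutoff_mul_heatKernel c).mul
        b.continuous).aestronglyMeasurable (.of_forall hM₁)
    have i2 : Integrable fun q : EuclideanSpace ℝ (Fin n) × ℝ =>
        timeCutoff c q.2 * k q * U (p - q) :=
      hU'.bdd_mul (c := M) (((contDiff_timeCutoff c).continuous.comp continuous_snd).mul
        hkc).aestronglyMeasurable (.of_forall fun q => by
          rw [norm_mul]
          exact (mul_le_of_le_one_left (norm_nonneg _) (abs_timeCutoff_le _ _)).trans (hM q))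
    rw [← sub_eq_zero, ← integral_sub i1 i2, ← h2]
    refine integral_congr_ae (.of_forall fun q => ?_)
    simp only [heatOp_nearKernel b hc]
    ring
  have := tendsto_nhds_unique (lim1.congr' heq) lim2
  rw [this, ← integral_sub_left_eq_self _ volume p]
  simp [mul_comm]

theorem contDiff_convolution_heatOp_farKernel
    (b : ContDiffBump (0 : EuclideanSpace ℝ (Fin n) × ℝ)) (hU : Integrable U) :
    ContDiff ℝ ∞ fun p => ∫ q, U q * heatOp (farKernel b) (p - q) :=
  (hasCompactSupport_heatOp_farKernel b).contDiff_convolution_right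
    (ContinuousLinearMap.mul ℝ ℝ) hU.locallyIntegrable (contDiff_farKernel b).heatOp

end Representation

/-! ### Locality of the classical heat equation. -/

section Gluing

variable {n : ℕ}

theorem ContDiff.isC21On {V : EuclideanSpace ℝ (Fin n) × ℝ → ℝ} (hV : ContDiff ℝ ∞ V)
    (A : Set (EuclideanSpace ℝ (Fin n))) (B : Set ℝ) : IsC21On A B (fun x t => V (x, t)) := by
  have h1 : ContDiff ℝ ∞ (fun p : EuclideanSpace ℝ (Fin n) × ℝ =>
      fderiv ℝ (fun y => V (y, p.2)) p.1) :=
    ContDiff.fderiv (n := ∞)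
      (f := fun (p : EuclideanSpace ℝ (Fin n) × ℝ) (y : EuclideanSpace ℝ (Fin n)) => V (y, p.2))
      (hV.comp (contDiff_snd.prodMk (contDiff_snd.comp contDiff_fst))) contDiff_fst (by simp)
  have h2 : ContDiff ℝ ∞ (fun p : EuclideanSpace ℝ (Fin n) × ℝ =>
      fderiv ℝ (fderiv ℝ (fun y => V (y, p.2))) p.1) :=
    ContDiff.fderiv (n := ∞)
      (f := fun (p : EuclideanSpace ℝ (Fin n) × ℝ) (y : EuclideanSpace ℝ (Fin n)) =>
        fderiv ℝ (fun z => V (z, p.2)) y)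
      (h1.comp (contDiff_snd.prodMk (contDiff_snd.comp contDiff_fst))) contDiff_fst (by simp)
  have h3 : ContDiff ℝ ∞ (fun p : EuclideanSpace ℝ (Fin n) × ℝ =>
      deriv (fun s => V (p.1, s)) p.2) := by
    simp only [← fderiv_apply_one_eq_deriv]
    refine ContDiff.clm_apply (ContDiff.fderiv (n := ∞)
      (f := fun (p : EuclideanSpace ℝ (Fin n) × ℝ) (s : ℝ) => V (p.1, s))
      (hV.comp ((contDiff_fst.comp contDiff_fst).prodMk contDiff_snd)) contDiff_snd (by simp))
      contDiff_const
  exact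
    { contDiffAt_space := fun x _ t _ =>
        (contDiff_infty.1 (hV.comp (contDiff_id.prodMk contDiff_const)) 2).contDiffAt
      differentiableAt_time := fun x _ t _ =>
        ((hV.comp (contDiff_const.prodMk contDiff_id)).differentiable (by simp)).differentiableAt
      continuousOn := hV.continuous.continuousOn
      continuousOn_fderiv := h1.continuous.continuousOn
      continuousOn_fderiv_fderiv := h2.continuous.continuousOn
      continuousOn_deriv_time := h3.continuous.continuousOn }

theorem IsClassicalHeatSolution.of_local {U : Set (EuclideanSpace ℝ (Fin n))} {I : Set ℝ}
    {v : EuclideanSpace ℝ (Fin n) → ℝ → ℝ}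
    (h : ∀ x ∈ U, ∀ t ∈ I, ∃ A B, IsOpen A ∧ IsOpen B ∧ x ∈ A ∧ t ∈ B ∧
      ∃ w, IsClassicalHeatSolution A B w ∧ ∀ y ∈ A, ∀ s ∈ B, v y s = w y s) :
    IsClassicalHeatSolution U I v := by
  choose! A B hA hB hxA htB w hw hvw using h
  have space {x t} (hx : x ∈ U) (ht : t ∈ I) {y s} (hy : y ∈ A x t) (hs : s ∈ B x t) :
      (fun z => v z s) =ᶠ[𝓝 y] fun z => w x t z s := by
    filter_upwards [(hA x hx t ht).mem_nhds hy] with z hz using hvw x hx t ht z hz s hs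
  have time {x t} (hx : x ∈ U) (ht : t ∈ I) {y s} (hy : y ∈ A x t) (hs : s ∈ B x t) :
      (fun z => v y z) =ᶠ[𝓝 s] fun z => w x t y z := by
    filter_upwards [(hB x hx t ht).mem_nhds hs] with z hz using hvw x hx t ht y hy z hz
  have nhd {x t} (hx : x ∈ U) (ht : t ∈ I) : A x t ×ˢ B x t ∈ 𝓝 (x, t) :=
    prod_mem_nhds ((hA x hx t ht).mem_nhds (hxA x hx t ht))
      ((hB x hx t ht).mem_nhds (htB x hx t ht))
  refine ⟨⟨fun x hx t ht => ?_, fun x hx t ht => ?_, ?_, ?_, ?_, ?_⟩, fun x hx t ht => ?_⟩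
  · exact ((hw x hx t ht).isC21On.contDiffAt_space x (hxA x hx t ht) t
      (htB x hx t ht)).congr_of_eventuallyEq (space hx ht (hxA x hx t ht) (htB x hx t ht))
  · exact ((hw x hx t ht).isC21On.differentiableAt_time x (hxA x hx t ht) t
      (htB x hx t ht)).congr_of_eventuallyEq (time hx ht (hxA x hx t ht) (htB x hx t ht))
  · rintro ⟨x, t⟩ ⟨hx, ht⟩
    refine (((hw x hx t ht).isC21On.continuousOn.continuousAt (nhd hx ht)).congr
      ?_).continuousWithinAt
    filter_upwards [nhd hx ht] with p hp using (hvw x hx t ht p.1 hp.1 p.2 hp.2).symm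
  · rintro ⟨x, t⟩ ⟨hx, ht⟩
    refine (((hw x hx t ht).isC21On.continuousOn_fderiv.continuousAt (nhd hx ht)).congr
      ?_).continuousWithinAt
    filter_upwards [nhd hx ht] with p hp using (space hx ht hp.1 hp.2).symm.fderiv_eq
  · rintro ⟨x, t⟩ ⟨hx, ht⟩
    refine (((hw x hx t ht).isC21On.continuousOn_fderiv_fderiv.continuousAt (nhd hx ht)).congr
      ?_).continuousWithinAt
    filter_upwards [nhd hx ht] with p hp using (space hx ht hp.1 hp.2).symm.fderiv.fderiv_eq
  · rintro ⟨x, t⟩ ⟨hx, ht⟩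
    refine (((hw x hx t ht).isC21On.continuousOn_deriv_time.continuousAt (nhd hx ht)).congr
      ?_).continuousWithinAt
    filter_upwards [nhd hx ht] with p hp using (time hx ht hp.1 hp.2).symm.deriv_eq
  · rw [(time hx ht (hxA x hx t ht) (htB x hx t ht)).deriv_eq,
      (InnerProductSpace.laplacian_congr_nhds
        (space hx ht (hxA x hx t ht) (htB x hx t ht))).eq_of_nhds]
    exact (hw x hx t ht).heat_eq x (hxA x hx t ht) t (htB x hx t ht)

/-- The heat equation for a smooth function extends across an isolated point. -/
theorem isClassicalHeatSolution_of_punctured [Nonempty (Fin n)]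
    {V : EuclideanSpace ℝ (Fin n) × ℝ → ℝ} (hV : ContDiff ℝ ∞ V)
    {A : Set (EuclideanSpace ℝ (Fin n))} {B : Set ℝ} (hA : IsOpen A) (hB : IsOpen B)
    {u : EuclideanSpace ℝ (Fin n) → ℝ → ℝ} (hu : IsClassicalHeatSolution (A \ {0}) B u)
    (huV : ∀ x ∈ A \ {0}, ∀ t ∈ B, u x t = V (x, t)) :
    IsClassicalHeatSolution A B (fun x t => V (x, t)) := by
  have hc := hV.isC21On univ univ
  have hA0 : IsOpen (A \ {0}) := hA.sdiff isClosed_singleton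
  have punct : ∀ x ∈ A \ {0}, ∀ t ∈ B,
      deriv (fun s => V (x, s)) t = Laplacian.laplacian (fun y => V (y, t)) x := by
    intro x hx t ht
    have e1 : (fun s => u x s) =ᶠ[𝓝 t] fun s => V (x, s) := by
      filter_upwards [hB.mem_nhds ht] with s hs using huV x hx s hs
    have e2 : (fun y => u y t) =ᶠ[𝓝 x] fun y => V (y, t) := by
      filter_upwards [hA0.mem_nhds hx] with y hy using huV y hy t ht
    rw [← e1.deriv_eq, ← (InnerProductSpace.laplacian_congr_nhds e2).eq_of_nhds]
    exact hu.heat_eq x hx t ht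
  refine ⟨hV.isC21On A B, fun x hx t ht => ?_⟩
  by_cases h0 : x = 0
  · subst h0
    have hi : Continuous fun y : EuclideanSpace ℝ (Fin n) => (y, t) := by fun_prop
    have c1 : Continuous fun y : EuclideanSpace ℝ (Fin n) => deriv (fun s => V (y, s)) t := by
      have := hc.continuousOn_deriv_time
      rw [univ_prod_univ, continuousOn_univ] at this
      exact this.comp hi
    have c2 : Continuous fun y : EuclideanSpace ℝ (Fin n) =>
        Laplacian.laplacian (fun z => V (z, t)) y := by
      have := hc.continuousOn_fderiv_fderiv
      rw [univ_prod_univ, continuousOn_univ] at this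
      simp only [laplacian_eq_sum_fderiv_fderiv]
      exact continuous_finsetSum _ fun i _ =>
        ((this.comp hi).clm_apply continuous_const).clm_apply continuous_const
    have l1 := (c1.tendsto 0).mono_left (nhdsWithin_le_nhds (s := {0}ᶜ))
    have l2 := (c2.tendsto 0).mono_left (nhdsWithin_le_nhds (s := {0}ᶜ))
    -- Both sides are continuous in `y` and agree for `y ≠ 0`; uniqueness of the limit needs 0 not
    -- to be isolated, hence positive dimension.
    refine tendsto_nhds_unique (l1.congr' ?_) l2
    filter_upwards [self_mem_nhdsWithin, nhdsWithin_le_nhds (hA.mem_nhds hx)] with y hy hyA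
    exact punct y ⟨hyA, hy⟩ t ht
  · exact punct x ⟨hx, h0⟩ t ht

theorem zpow_two_sub_natCast {n : ℕ} (hn : 2 ≤ n) (a : ℝ) :
    a ^ (2 - (n : ℤ)) = (a ^ (n - 2))⁻¹ := by
  have : 2 - (n : ℤ) = -((n - 2 : ℕ) : ℤ) := by omega
  rw [this, zpow_neg, zpow_natCast]

end Gluing

/-! ### Local extension, gluing, and the equivalence. -/

section Removability

variable {n : ℕ} {Ω : Set (EuclideanSpace ℝ (Fin n))} {T : ℝ}
  {u : EuclideanSpace ℝ (Fin n) → ℝ → ℝ}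

/-- Near each point of the singular line, a solution which is `o(|x| ^ (2 - n))` agrees with a
smooth function. -/
theorem IsClassicalHeatSolution.exists_contDiff_eq (hn : 3 ≤ n) (hΩ : IsOpen Ω)
    (hu : IsClassicalHeatSolution (Ω \ {0}) (Ioo 0 T) u)
    (hdec : ∀ t₁ t₂ δ : ℝ, 0 < t₁ → t₁ < t₂ → t₂ < T → 0 < δ → δ < 1 →
        ∃ R₀ : ℝ, 0 < R₀ ∧ Metric.closedBall (0 : EuclideanSpace ℝ (Fin n)) R₀ ⊆ Ω ∧
          ∀ x : EuclideanSpace ℝ (Fin n), 0 < ‖x‖ → ‖x‖ ≤ R₀ → ∀ t ∈ Icc t₁ t₂,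
            |u x t| ≤ δ * (‖x‖ ^ (n - 2))⁻¹) {t₀ : ℝ} (ht₀ : t₀ ∈ Ioo 0 T) :
    ∃ r, 0 < r ∧ ∃ V : EuclideanSpace ℝ (Fin n) × ℝ → ℝ, ContDiff ℝ ∞ V ∧
      Metric.ball 0 r ⊆ Ω ∧ Ioo (t₀ - r) (t₀ + r) ⊆ Ioo 0 T ∧
      ∀ x ∈ Metric.ball 0 r \ {0}, ∀ t ∈ Ioo (t₀ - r) (t₀ + r), u x t = V (x, t) := by
  obtain ⟨h0, hT⟩ := ht₀
  have l1 : 0 < t₀ / 2 := by linarith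
  have l2 : t₀ / 2 < (t₀ + T) / 2 := by linarith
  have l3 : (t₀ + T) / 2 < T := by linarith
  obtain ⟨R, hR, hRΩ, hRu⟩ := hdec (t₀ / 2) ((t₀ + T) / 2) (1 / 2) l1 l2 l3 (by norm_num)
    (by norm_num)
  -- The growth condition is given only for `δ < 1`; taking `min δ (1/2)` yields it for every
  -- positive `δ`.
  have hdec' : ∀ δ, 0 < δ → ∃ R, 0 < R ∧ ∀ x : EuclideanSpace ℝ (Fin n), 0 < ‖x‖ → ‖x‖ ≤ R →
      ∀ t ∈ Icc (t₀ / 2) ((t₀ + T) / 2), |u x t| ≤ δ * (‖x‖ ^ (n - 2))⁻¹ := by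
    intro δ hδ
    obtain ⟨R', hR', -, h⟩ := hdec (t₀ / 2) ((t₀ + T) / 2) (min δ (1 / 2)) l1 l2 l3
      (by positivity) ((min_le_right _ _).trans_lt (by norm_num))
    refine ⟨R', hR', fun x hx hxR t ht => (h x hx hxR t ht).trans ?_⟩
    gcongr
    exact min_le_left _ _
  set S : Set (EuclideanSpace ℝ (Fin n) × ℝ) :=
    Metric.closedBall 0 R ×ˢ Icc (t₀ / 2) ((t₀ + T) / 2) with hS
  have hIcc : Icc (t₀ / 2) ((t₀ + T) / 2) ⊆ Ioo 0 T := fun t ht =>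
    ⟨l1.trans_le ht.1, ht.2.trans_lt l3⟩
  have hSmeas : MeasurableSet S := Metric.isClosed_closedBall.measurableSet.prod measurableSet_Icc
  have hSint : IntegrableOn (fun p : EuclideanSpace ℝ (Fin n) × ℝ => u p.1 p.2) S :=
    integrableOn_of_abs_le_inv_norm_pow hn (hu.isC21On.continuousOn.mono
      (prod_mono (sdiff_subset_sdiff_left hRΩ) hIcc)) hRu
  -- Cutting `u` off to the cylinder `S` gives a globally integrable function, as the convolution
  -- requires.
  set U : EuclideanSpace ℝ (Fin n) × ℝ → ℝ := S.indicator fun p => u p.1 p.2 with hUdef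
  have hU : Integrable U := (integrable_indicator_iff hSmeas).2 hSint
  -- With `2r` at most the radius of `S` and the distance from `t₀` to either end of its time
  -- interval, every closed `r`-ball about a point of the smaller cylinder stays in `S`.
  set r := min R (min (t₀ / 2) ((T - t₀) / 2)) / 2 with hr
  have hr0 : 0 < r := by
    have : 0 < (T - t₀) / 2 := by linarith
    positivity
  have r1 : 2 * r ≤ R := by rw [hr]; linarith [min_le_left R (min (t₀ / 2) ((T - t₀) / 2))]
  have r2 : 2 * r ≤ t₀ / 2 := by
    have := (min_le_right R (min (t₀ / 2) ((T - t₀) / 2))).trans (min_le_left _ _)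
    rw [hr]; linarith
  have r3 : 2 * r ≤ (T - t₀) / 2 := by
    have := (min_le_right R (min (t₀ / 2) ((T - t₀) / 2))).trans (min_le_right _ _)
    rw [hr]; linarith
  let b : ContDiffBump (0 : EuclideanSpace ℝ (Fin n) × ℝ) := ⟨r / 2, r, by positivity, by linarith⟩
  refine ⟨r, hr0, fun p => ∫ q, U q * heatOp (farKernel b) (p - q),
    contDiff_convolution_heatOp_farKernel b hU, ?_, ?_, ?_⟩
  · exact (Metric.ball_subset_closedBall.trans
      (Metric.closedBall_subset_closedBall (by linarith))).trans hRΩ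
  · exact fun t ht => ⟨by linarith [ht.1], by linarith [ht.2]⟩
  rintro x ⟨hx, hx0⟩ t ht
  have hball : Metric.closedBall (x, t) r ⊆ S := by
    intro q hq
    rw [mem_ball_zero_iff] at hx
    rw [Metric.mem_closedBall, Prod.dist_eq, max_le_iff, Real.dist_eq, abs_le] at hq
    refine ⟨?_, by linarith [hq.2.1, ht.1], by linarith [hq.2.2, ht.2]⟩
    rw [Metric.mem_closedBall]
    have := dist_triangle q.1 x 0
    rw [dist_zero_right x] at this
    linarith [hq.1]
  have hS_nhds : S ∈ 𝓝 (x, t) := mem_of_superset (Metric.closedBall_mem_nhds _ hr0) hball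
  have hxt : (x, t) ∈ (Ω \ {0}) ×ˢ Ioo 0 T := by
    have := mem_of_mem_nhds hS_nhds
    exact ⟨⟨hRΩ this.1, hx0⟩, hIcc this.2⟩
  have hUx : U =ᶠ[𝓝 (x, t)] fun p => u p.1 p.2 := by
    filter_upwards [hS_nhds] with p hp
    rw [hUdef, indicator_of_mem hp]
  have hcont : ContinuousAt U (x, t) :=
    (hu.isC21On.continuousOn.continuousAt
      (((hΩ.sdiff isClosed_singleton).prod isOpen_Ioo).mem_nhds hxt)).congr hUx.symm
  beta_reduce
  rw [← eq_integral_mul_heatOp_farKernel b hU hcont, hUx.eq_of_nhds]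
  intro φ hφ hsupp
  have hsS := hsupp.trans hball
  rw [← hu.integral_mul_eq_zero_of_removable hn hΩ l2.le hdec' hφ
    ((isCompact_closedBall _ _).of_isClosed_subset (isClosed_tsupport _) hsupp)
    (hsS.trans (prod_mono hRΩ hIcc)) (hsS.trans (prod_mono (subset_univ _) subset_rfl))
    (hSint.mono_set hsS)]
  refine integral_congr_ae (.of_forall fun q => ?_)
  simp only
  by_cases hq : q ∈ S
  · rw [hUdef, indicator_of_mem hq]
  · have hq' : q ∉ tsupport φ := fun h => hq (hsS h)
    rw [image_eq_zero_of_notMem_tsupport fun h => hq' (tsupport_dirDeriv_subset φ h),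
      image_eq_zero_of_notMem_tsupport fun h => hq' (tsupport_spaceLaplacian_subset φ h)]
    simp

theorem IsClassicalHeatSolution.mono {U U' : Set (EuclideanSpace ℝ (Fin n))} {I I' : Set ℝ}
    (hu : IsClassicalHeatSolution U I u) (hU : U' ⊆ U) (hI : I' ⊆ I) :
    IsClassicalHeatSolution U' I' u :=
  ⟨⟨fun x hx t ht => hu.isC21On.contDiffAt_space x (hU hx) t (hI ht),
    fun x hx t ht => hu.isC21On.differentiableAt_time x (hU hx) t (hI ht),
    hu.isC21On.continuousOn.mono (prod_mono hU hI),
    hu.isC21On.continuousOn_fderiv.mono (prod_mono hU hI),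
    hu.isC21On.continuousOn_fderiv_fderiv.mono (prod_mono hU hI),
    hu.isC21On.continuousOn_deriv_time.mono (prod_mono hU hI)⟩,
    fun x hx t ht => hu.heat_eq x (hU hx) t (hI ht)⟩

/-- Local smooth extensions across the singular line glue to a classical solution. -/
theorem hasRemovableSingularities_of_local [Nonempty (Fin n)] (hΩ : IsOpen Ω)
    (hu : IsClassicalHeatSolution (Ω \ {0}) (Ioo 0 T) u)
    (hloc : ∀ t₀ ∈ Ioo 0 T, ∃ r, 0 < r ∧ ∃ V : EuclideanSpace ℝ (Fin n) × ℝ → ℝ,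
      ContDiff ℝ ∞ V ∧ Metric.ball 0 r ⊆ Ω ∧ Ioo (t₀ - r) (t₀ + r) ⊆ Ioo 0 T ∧
      ∀ x ∈ Metric.ball 0 r \ {0}, ∀ t ∈ Ioo (t₀ - r) (t₀ + r), u x t = V (x, t)) :
    HasRemovableSingularities Ω T u := by
  classical
  choose! r hr V hV hball hIoo heq using hloc
  have hmem {t₀ : ℝ} (ht₀ : t₀ ∈ Ioo 0 T) : t₀ ∈ Ioo (t₀ - r t₀) (t₀ + r t₀) := by
    have := hr t₀ ht₀
    constructor <;> linarith
  -- Both values are the limit of `u x t` as `x → 0` with `t` fixed.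
  have consistent {t₀ t : ℝ} (ht₀ : t₀ ∈ Ioo 0 T) (ht : t ∈ Ioo (t₀ - r t₀) (t₀ + r t₀)) :
      V t (0, t) = V t₀ (0, t) := by
    have htT := hIoo t₀ ht₀ ht
    have c (s : ℝ) (hs : s ∈ Ioo 0 T) : Tendsto (fun x : EuclideanSpace ℝ (Fin n) => V s (x, t))
        (𝓝[≠] 0) (𝓝 (V s (0, t))) := by
      have : Continuous fun x : EuclideanSpace ℝ (Fin n) => V s (x, t) :=
        (hV s hs).continuous.comp (by fun_prop)
      exact (this.tendsto 0).mono_left nhdsWithin_le_nhds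
    refine tendsto_nhds_unique ((c t htT).congr' ?_) (c t₀ ht₀)
    filter_upwards [self_mem_nhdsWithin,
      nhdsWithin_le_nhds (Metric.ball_mem_nhds (0 : EuclideanSpace ℝ (Fin n)) (hr t htT)),
      nhdsWithin_le_nhds (Metric.ball_mem_nhds (0 : EuclideanSpace ℝ (Fin n)) (hr t₀ ht₀))]
      with x hx h1 h2
    rw [← heq t htT x ⟨h1, hx⟩ t (hmem htT), heq t₀ ht₀ x ⟨h2, hx⟩ t ht]
  -- On the line each time uses its own local extension; by `consistent` a single one serves on a
  -- whole time interval.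
  refine ⟨fun x t => if x = 0 then V t (0, t) else u x t, .of_local fun x hx t ht => ?_,
    fun x hx t _ => (if_neg hx.2).symm⟩
  by_cases hx0 : x = 0
  · subst hx0
    refine ⟨Metric.ball 0 (r t), Ioo (t - r t) (t + r t), Metric.isOpen_ball, isOpen_Ioo,
      Metric.mem_ball_self (hr t ht), hmem ht, fun y s => V t (y, s),
      isClassicalHeatSolution_of_punctured (hV t ht) Metric.isOpen_ball isOpen_Ioo
        (hu.mono (sdiff_subset_sdiff_left (hball t ht)) (hIoo t ht)) (heq t ht), fun y hy s hs => ?_⟩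
    split_ifs with h
    · rw [h, consistent ht hs]
    · exact heq t ht y ⟨hy, h⟩ s hs
  · exact ⟨Ω \ {0}, Ioo 0 T, hΩ.sdiff isClosed_singleton, isOpen_Ioo, ⟨hx, hx0⟩, ht, u, hu,
      fun y hy s _ => if_neg hy.2⟩

/-- With `|v| ≤ |M|` on a compact cylinder and `|x| ≤ 1`, one has `|v| |x|^(n-2) ≤ |M| |x|` because
`n - 2 ≥ 1`; then `|x| ≤ δ/(|M| + 1)` suffices. -/
theorem HasRemovableSingularities.abs_le (hn : 3 ≤ n) (hΩ : IsOpen Ω) (h0 : 0 ∈ Ω)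
    (h : HasRemovableSingularities Ω T u) {t₁ t₂ δ : ℝ} (ht₁ : 0 < t₁) (ht₂ : t₂ < T)
    (hδ : 0 < δ) :
    ∃ R₀ : ℝ, 0 < R₀ ∧ Metric.closedBall (0 : EuclideanSpace ℝ (Fin n)) R₀ ⊆ Ω ∧
      ∀ x : EuclideanSpace ℝ (Fin n), 0 < ‖x‖ → ‖x‖ ≤ R₀ → ∀ t ∈ Icc t₁ t₂,
        |u x t| ≤ δ * (‖x‖ ^ (n - 2))⁻¹ := by
  obtain ⟨v, hv, huv⟩ := h
  obtain ⟨R, hR, hRΩ⟩ := Metric.nhds_basis_closedBall.mem_iff.1 (hΩ.mem_nhds h0)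
  have hIcc : Icc t₁ t₂ ⊆ Ioo 0 T := fun t ht => ⟨ht₁.trans_le ht.1, ht.2.trans_lt ht₂⟩
  obtain ⟨M, hM⟩ := ((isCompact_closedBall (0 : EuclideanSpace ℝ (Fin n)) R).prod
    (isCompact_Icc (a := t₁) (b := t₂))).exists_bound_of_continuousOn
    (hv.isC21On.continuousOn.mono (prod_mono hRΩ hIcc))
  have hpos : 0 < min R (min 1 (δ / (|M| + 1))) := by positivity
  refine ⟨min R (min 1 (δ / (|M| + 1))), hpos,
    (Metric.closedBall_subset_closedBall (min_le_left _ _)).trans hRΩ, fun x hx hxR t ht => ?_⟩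
  have x1 : ‖x‖ ≤ R := hxR.trans (min_le_left _ _)
  have x2 : ‖x‖ ≤ 1 := hxR.trans ((min_le_right _ _).trans (min_le_left _ _))
  have x3 : ‖x‖ ≤ δ / (|M| + 1) := hxR.trans ((min_le_right _ _).trans (min_le_right _ _))
  have hxR' : x ∈ Metric.closedBall (0 : EuclideanSpace ℝ (Fin n)) R := by simpa using x1
  rw [huv x ⟨hRΩ hxR', norm_pos_iff.1 hx⟩ t (hIcc ht), ← div_eq_mul_inv,
    le_div_iff₀ (by positivity)]
  have hpow : ‖x‖ ^ (n - 2) ≤ ‖x‖ := pow_le_of_le_one hx.le x2 (by omega)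
  rw [le_div_iff₀ (by positivity)] at x3
  have hv' : |v x t| ≤ |M| := (hM (x, t) ⟨hxR', ht⟩).trans (le_abs_self M)
  calc |v x t| * ‖x‖ ^ (n - 2) ≤ |M| * ‖x‖ :=
        mul_le_mul hv' hpow (by positivity) (abs_nonneg _)
    _ ≤ δ := by nlinarith

end Removability

theorem theorem1 (n : ℕ) (hn : 3 ≤ n) (Ω : Set (EuclideanSpace ℝ (Fin n)))
    (hΩ_open : IsOpen Ω) (hΩ_conn : IsConnected Ω) (hΩ_zero : (0 : EuclideanSpace ℝ (Fin n)) ∈ Ω)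
    (T : ℝ) (hT : 0 < T) (u : EuclideanSpace ℝ (Fin n) → ℝ → ℝ)
    (hu : IsClassicalHeatSolution (Ω \ {0}) (Set.Ioo 0 T) u) :
    HasRemovableSingularities Ω T u ↔
      ∀ t₁ t₂ δ : ℝ, 0 < t₁ → t₁ < t₂ → t₂ < T → 0 < δ → δ < 1 →
        ∃ R₀ : ℝ, 0 < R₀ ∧ Metric.closedBall (0 : EuclideanSpace ℝ (Fin n)) R₀ ⊆ Ω ∧
          ∀ x : EuclideanSpace ℝ (Fin n), 0 < ‖x‖ → ‖x‖ ≤ R₀ → ∀ t ∈ Set.Icc t₁ t₂,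
            |u x t| ≤ δ * ‖x‖ ^ (2 - (n : ℤ)) := by
  have : Nonempty (Fin n) := ⟨⟨0, by omega⟩⟩
  simp only [zpow_two_sub_natCast (by omega : 2 ≤ n)]
  exact ⟨fun h t₁ t₂ δ h1 _ h2 hδ _ => h.abs_le hn hΩ_open hΩ_zero h1 h2 hδ,
    fun h => hasRemovableSingularities_of_local hΩ_open hu fun _ ht₀ =>
      hu.exists_contDiff_eq hn hΩ_open h ht₀⟩
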